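/- **Theorem (existence and uniqueness for routed and non-routed classes and multiple destinations).** Let $(\mathcal V,\mathcal A)$, $\mathcal A\subseteq\mathcal V\times\mathcal V$, be a finite, connected directed graph without directed cycles, let $\mathcal A_{\rm in}(v)$ and $\mathcal A_{\rm out}(v)$ be the sets of links that end, respectively originate, in the node $v$, let $\mathcal D\subseteq\mathcal V$ be a set of destinations, and let $K=\{{\rm r},{\rm nr}\}\times\mathcal D$ be the set of commodities. Let $T>0$, $p\in[1,\infty)$, $b,d\in[0,1]$, and for all $a\in\mathcal A$, $k\in K$ let the following be given: * $\lambda_a\in C^1([0,T]\times\mathbb R;\mathbb R_{>0})$; * initial data $\rho^k_{a,0}\in L^\infty((0,1);\mathbb R_{\ge0})$; * sources $s_a^{v,k}\in L^\infty((0,T);\mathbb R_{\ge 0})$, where $v$ is the node in which $a$ originates; * splits $\theta_a^{v,k}\in L^\infty((0,T);\mathbb R_{\ge0})$, $a\in\mathcal A_{\rm out}(v)$, such that $\theta_a^{v,k}=0$ a.e. if the destination of $k$ cannot be reached through $a$ (there is no directed path, possibly of length zero, from the end node of $a$ to it), and $\sum_{a\in\mathcal A_{\rm out}(v)}\theta_a^{v,k}(t)=1$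 for a.e. $t$ at every node $v$ at which the destination of $k$ can be reached through at least one link in $\mathcal A_{\rm out}(v)$. Consider the system, for all $a\in\mathcal A$ and $k\in K$, with $\rho_a:=\sum_{k\in K}\rho_a^k$ and $c_a(t):=\lambda_a\big(t,\int_b^d\rho_a(t,x)\,dx\big)$, $$\partial_t\rho_a^k+\partial_x\big(c_a\rho_a^k\big)=0\ \text{ on }(0,T)\times(0,1),\qquad \rho_a^k(0,\cdot)=\rho_{a,0}^k,\qquad c_a\rho_a^k(\cdot,0)=u_a^k,\qquad c_a\rho_a^k(\cdot,1)=y_a^k,$$ $$u_a^k(t)=s_a^{v,k}(t)+\theta_a^{v,k}(t)\sum_{\tilde a\in\mathcal A_{\rm in}(v)}y_{\tilde a}^k(t)\qquad\text{for a.e. }t\in(0,T),\ v\in\mathcal V,\ a\in\mathcal A_{\rm out}(v),\ k\in K.$$ A weak solution consists of $\rho_a^k\in C([0,T];L^p((0,1)))$ and $u_a^k,y_a^k\in L^1((0,T))$ that satisfy the node conditions and, for every $\varphi\in C^1(\mathbb R^2)$ with $\varphi(T,x)=0$ for $x\in[0,1]$, $$\int_0^T\!\!\int_0^1\rho_a^k\,(\partial_t\varphi+c_a\,\partial_x\varphi)\,dx\,dt+\int_0^1\rho_{a,0}^k(x)\varphi(0,x)\,dx+\int_0^Tu_a^k(t)\varphi(t,0)\,dt-\int_0^Ty_a^k(t)\varphi(t,1)\,dt=0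 .$$ Then there is exactly one weak solution (with $u_a^k,y_a^k$ identified up to null sets), all $\rho_a^k$, $u_a^k$, $y_a^k$ are non-negative (almost everywhere), and $$\rho_a^k\in C([0,T];L^p((0,1)))\cap L^\infty((0,T);L^\infty((0,1)))\qquad\forall a\in\mathcal A,\ k\in K.$$ -/

import Mathlib

open MeasureTheory Set
open scoped ENNReal

/-- A (finite) network: a directed graph with node set `V` and arcs in `V × V` which is connected
(as an undirected graph). -/
structure TrafficNetwork (V : Type*) [Fintype V] [DecidableEq V] where
  arcs : Finset (V × V)
  connected : (SimpleGraph.fromRel fun v w => (v, w) ∈ arcs).Connected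

namespace TrafficNetwork

variable {V : Type*} [Fintype V] [DecidableEq V]

/-- The links of the network. -/
abbrev Link (N : TrafficNetwork V) : Type _ := {a : V × V // a ∈ N.arcs}

/-- The node in which a link originates. -/
def origin {N : TrafficNetwork V} (a : N.Link) : V := a.1.1

/-- The node in which a link ends. -/
def terminus {N : TrafficNetwork V} (a : N.Link) : V := a.1.2

/-- The links which end in `v`. -/
def linksIn (N : TrafficNetwork V) (v : V) : Finset N.Link :=
  Finset.univ.filter fun a => terminus a = v

/-- The links which originate in `v`. -/
def linksOut (N : TrafficNetwork V) (v : V) : Finset N.Link :=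
  Finset.univ.filter fun a => origin a = v

/-- There is no directed cycle: no node can be reached from itself along one or more links. -/
def Acyclic (N : TrafficNetwork V) : Prop :=
  ∀ v : V, ¬ Relation.TransGen (fun v w => (v, w) ∈ N.arcs) v v

/-- The node `z` can be reached through the link `a`: there is a directed path (possibly of
length zero) from the end node of `a` to `z`. -/
def ReachableThrough {N : TrafficNetwork V} (a : N.Link) (z : V) : Prop :=
  Relation.ReflTransGen (fun v w => (v, w) ∈ N.arcs) (terminus a) z

end TrafficNetwork

/-- The two classes of drivers. -/
inductive DriverClass where
  | routed : DriverClass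
  | nonRouted : DriverClass
  deriving DecidableEq

instance : Fintype DriverClass where
  elems := {DriverClass.routed, DriverClass.nonRouted}
  complete := by intro c; cases c <;> simp

/-- The commodities: pairs of a class of drivers and a destination. -/
abbrev Commodity {V : Type*} (D : Finset V) : Type _ := DriverClass × {v : V // v ∈ D}

/-- `f ∈ L^∞(I; ℝ_{≥0})`. -/
def IsNonnegLinfty (I : Set ℝ) (f : ℝ → ℝ) : Prop :=
  MemLp f ∞ (volume.restrict I) ∧ ∀ᵐ t ∂volume.restrict I, 0 ≤ f t

/-- The real Lebesgue space `L^p((0,1))`. -/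
noncomputable abbrev LpUnit (p : ℝ≥0∞) := Lp ℝ p (volume.restrict (Ioo (0 : ℝ) 1))

namespace TrafficNetwork

variable {V : Type*} [Fintype V] [DecidableEq V]

/-- The set of splits. Since `a` determines the node `v` in which it originates, the split
`θ_a^{v,k}` is written `θ a k`. A commodity is never sent into a link through which its destination
cannot be reached, and at a node from which its destination can be reached through at least one
outgoing link the splits over the outgoing links add up to one. -/
structure IsSplit (N : TrafficNetwork V) (D : Finset V) (T : ℝ)
    (θ : N.Link → Commodity D → ℝ → ℝ) : Prop where
  nonneg_linfty : ∀ a k, IsNonnegLinfty (Ioo 0 T) (θ a k)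
  eq_zero : ∀ a (k : Commodity D), ¬ ReachableThrough a (k.2 : V) →
    ∀ᵐ t ∂volume.restrict (Ioo 0 T), θ a k t = 0
  sum_eq_one : ∀ (v : V) (k : Commodity D),
    (∃ a ∈ N.linksOut v, ReachableThrough a (k.2 : V)) →
    ∀ᵐ t ∂volume.restrict (Ioo 0 T), ∑ a ∈ N.linksOut v, θ a k t = 1

end TrafficNetwork

/-- The velocity `λ(t, ∫_b^d ∑_k ρ^k(t,y) dy)` on a link at time `t`, common to all commodities. -/
noncomputable def linkVelocity {K : Type*} [Fintype K] {p : ℝ≥0∞} (lam : ℝ → ℝ → ℝ) (b d : ℝ)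
    (ρ : K → ℝ → LpUnit p) (t : ℝ) : ℝ :=
  lam t (∫ x in b..d, ∑ k, ρ k t x)

/-- `r` is a weak solution of `∂_t r + ∂_x (c(t) r) = 0` on `(0,T) × (0,1)` with
`r(0,x) = r0(x)`, `c(t) r(t,0) = u(t)` and `c(t) r(t,1) = y(t)`: the equation is multiplied by a
test function which vanishes at `t = T`, and integrated by parts. As the test function is arbitrary
at `t = 0`, `x = 0` and `x = 1`, the identity contains the initial condition and says that `u`
and `y` are the traces of the flux at the two ends. -/
def IsWeakTransportSolution {p : ℝ≥0∞} (T : ℝ) (c : ℝ → ℝ) (r0 u y : ℝ → ℝ)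
    (r : ℝ → LpUnit p) : Prop :=
  ∀ φ : ℝ × ℝ → ℝ, ContDiff ℝ 1 φ → (∀ x ∈ Icc (0 : ℝ) 1, φ (T, x) = 0) →
    (∫ t in (0 : ℝ)..T, ∫ x in (0 : ℝ)..1,
        r t x * (fderiv ℝ φ (t, x) (1, 0) + c t * fderiv ℝ φ (t, x) (0, 1)))
      + (∫ x in (0 : ℝ)..1, r0 x * φ (0, x))
      + (∫ t in (0 : ℝ)..T, u t * φ (t, 0))
      - (∫ t in (0 : ℝ)..T, y t * φ (t, 1)) = 0

namespace TrafficNetwork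

variable {V : Type*} [Fintype V] [DecidableEq V]

/-- `(ρ, u, y)` (densities, inflows and outflows of all commodities on all links) is a weak solution
of the multi-commodity non-local model on the network, with `ρ_a^k ∈ C([0,T]; L^p((0,1)))`. -/
structure IsWeakSolution {p : ℝ≥0∞} [Fact (1 ≤ p)] (N : TrafficNetwork V) (D : Finset V)
    (T : ℝ) (lam : N.Link → ℝ → ℝ → ℝ) (b d : ℝ)
    (ρ0 θ s : N.Link → Commodity D → ℝ → ℝ)
    (ρ : N.Link → Commodity D → ℝ → LpUnit p) (u y : N.Link → Commodity D → ℝ → ℝ) : Prop where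
  continuousOn : ∀ a k, ContinuousOn (ρ a k) (Icc 0 T)
  integrable_inflow : ∀ a k, IntegrableOn (u a k) (Ioo 0 T)
  integrable_outflow : ∀ a k, IntegrableOn (y a k) (Ioo 0 T)
  weak : ∀ a k,
    IsWeakTransportSolution T (linkVelocity (lam a) b d (ρ a)) (ρ0 a k) (u a k) (y a k) (ρ a k)
  node : ∀ a k, ∀ᵐ t ∂volume.restrict (Ioo 0 T),
    u a k t = s a k t + θ a k t * ∑ a' ∈ N.linksIn (origin a), y a' k t

end TrafficNetwork

/-!
On a single link all commodities move with the same velocity `c`, so a weak solution has no choice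
but to transport its data along the characteristics of `c`: tested with functions which are constant
along characteristics up to a factor depending on time only, a solution with zero data vanishes.
Hence a solution on a link amounts to a velocity with `c t = λ (t, load)`, where the load is the one
produced by transporting the data with the velocity `c`. Written with a primitive of the data, two
loads at time `t` differ by at most a constant times `∫₀ᵗ |c₁ - c₂|`, although the data are merely
bounded. So the map `c ↦ λ (·, load)` is of Volterra type, an iterate of it is a contraction, and
the velocity exists and is unique. The outflow of a link is again non-negative and bounded, which
allows one to go through the links one after the other along the acyclic order.
-/

/-! ### Velocities and their characteristics -/

/-- A velocity, for all times, which is continuous and bounded away from zero. A velocity which is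
only given on `[0, T]` is extended, see `exists_isVelocity_eqOn`. -/
structure IsVelocity (m : ℝ) (c : ℝ → ℝ) : Prop where
  pos : 0 < m
  continuous : Continuous c
  lower : ∀ t, m ≤ c t

/-- The distance covered between time `0` and time `t` at velocity `c`. -/
noncomputable def displacement (c : ℝ → ℝ) (t : ℝ) : ℝ := ∫ s in (0 : ℝ)..t, c s

/-- The time at which the displacement attains a given value; it is the inverse of `displacement c`
as soon as `c` is a velocity in the sense of `IsVelocity`. -/
noncomputable def passage (c : ℝ → ℝ) : ℝ → ℝ := Function.invFun (displacement c)

@[simp] lemma displacement_zero (c : ℝ → ℝ) : displacement c 0 = 0 := by simp [displacement]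

lemma exists_isVelocity_eqOn {c : ℝ → ℝ} {T : ℝ} (hT : 0 ≤ T) (hc : ContinuousOn c (Icc 0 T))
    (hpos : ∀ t ∈ Icc 0 T, 0 < c t) : ∃ m c', IsVelocity m c' ∧ EqOn c' c (Icc 0 T) := by
  obtain ⟨t₀, ht₀, hmin⟩ := isCompact_Icc.exists_isMinOn ⟨0, left_mem_Icc.2 hT⟩ hc
  refine ⟨c t₀, IccExtend hT ((Icc 0 T).domRestrict c), ⟨hpos _ ht₀,
    (continuousOn_iff_continuous_domRestrict.1 hc).Icc_extend', fun t => ?_⟩,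
    fun t ht => IccExtend_of_mem hT _ ht⟩
  exact hmin (projIcc 0 T hT t).2

namespace IsVelocity

variable {m : ℝ} {c : ℝ → ℝ}

lemma velocity_pos (h : IsVelocity m c) (t : ℝ) : 0 < c t := h.pos.trans_le (h.lower t)

lemma hasDerivAt_displacement (h : IsVelocity m c) (t : ℝ) :
    HasDerivAt (displacement c) (c t) t :=
  intervalIntegral.integral_hasDerivAt_right (h.continuous.intervalIntegrable _ _)
    (h.continuous.stronglyMeasurableAtFilter _ _) h.continuous.continuousAt

lemma contDiff_displacement (h : IsVelocity m c) : ContDiff ℝ 1 (displacement c) := by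
  refine contDiff_one_iff_deriv.2 ⟨fun t => (h.hasDerivAt_displacement t).differentiableAt, ?_⟩
  rw [funext fun t => (h.hasDerivAt_displacement t).deriv]
  exact h.continuous

lemma continuous_displacement (h : IsVelocity m c) : Continuous (displacement c) :=
  h.contDiff_displacement.continuous

lemma displacement_sub (h : IsVelocity m c) (s t : ℝ) :
    displacement c t - displacement c s = ∫ r in s..t, c r :=
  intervalIntegral.integral_interval_sub_left (h.continuous.intervalIntegrable _ _)
    (h.continuous.intervalIntegrable _ _)

lemma mul_sub_le (h : IsVelocity m c) {s t : ℝ} (hst : s ≤ t) :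
    m * (t - s) ≤ displacement c t - displacement c s := by
  rw [h.displacement_sub]
  have := intervalIntegral.integral_mono_on (f := fun _ => m) (g := c) (μ := volume) hst
    (by simp) (h.continuous.intervalIntegrable _ _) (fun x _ => h.lower x)
  simpa [mul_comm] using this

lemma strictMono_displacement (h : IsVelocity m c) : StrictMono (displacement c) :=
  fun s t hst => by linarith [h.mul_sub_le hst.le, mul_pos h.pos (sub_pos.2 hst)]

lemma displacement_nonneg (h : IsVelocity m c) {t : ℝ} (ht : 0 ≤ t) : 0 ≤ displacement c t :=
  displacement_zero c ▸ h.strictMono_displacement.monotone ht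

lemma mul_abs_sub_le (h : IsVelocity m c) (s t : ℝ) :
    m * |t - s| ≤ |displacement c t - displacement c s| := by
  wlog hst : s ≤ t generalizing s t
  · simpa only [abs_sub_comm] using this t s (le_of_not_ge hst)
  rw [abs_of_nonneg (sub_nonneg.2 hst),
    abs_of_nonneg (sub_nonneg.2 (h.strictMono_displacement.monotone hst))]
  exact h.mul_sub_le hst

lemma surjective_displacement (h : IsVelocity m c) : Function.Surjective (displacement c) := by
  refine h.continuous_displacement.surjective ?_ ?_
  · refine Filter.tendsto_atTop_mono' _ ?_ (Filter.tendsto_id.const_mul_atTop h.pos)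
    filter_upwards [Filter.eventually_ge_atTop 0] with t ht
    simpa using h.mul_sub_le ht
  · refine Filter.tendsto_atBot_mono' _ ?_ (Filter.tendsto_id.const_mul_atBot h.pos)
    filter_upwards [Filter.eventually_le_atBot 0] with t ht
    simpa using h.mul_sub_le ht

lemma displacement_passage (h : IsVelocity m c) (z : ℝ) :
    displacement c (passage c z) = z :=
  Function.rightInverse_invFun h.surjective_displacement z

lemma passage_displacement (h : IsVelocity m c) (t : ℝ) :
    passage c (displacement c t) = t :=
  Function.leftInverse_invFun h.strictMono_displacement.injective t

lemma continuous_passage (h : IsVelocity m c) : Continuous (passage c) := by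
  refine (LipschitzWith.of_dist_le_mul (K := Real.toNNReal m⁻¹) fun z w => ?_).continuous
  rw [Real.dist_eq, Real.dist_eq, Real.coe_toNNReal _ (inv_nonneg.2 h.pos.le), inv_mul_eq_div,
    le_div_iff₀' h.pos]
  simpa only [h.displacement_passage] using h.mul_abs_sub_le (passage c w) (passage c z)

lemma passage_le_iff (h : IsVelocity m c) {z t : ℝ} : passage c z ≤ t ↔ z ≤ displacement c t := by
  rw [← h.strictMono_displacement.le_iff_le, h.displacement_passage]

lemma lt_passage_iff (h : IsVelocity m c) {z t : ℝ} : t < passage c z ↔ displacement c t < z := by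
  rw [← h.strictMono_displacement.lt_iff_lt, h.displacement_passage]

lemma le_passage_iff (h : IsVelocity m c) {z t : ℝ} : t ≤ passage c z ↔ displacement c t ≤ z := by
  rw [← h.strictMono_displacement.le_iff_le, h.displacement_passage]

lemma passage_nonneg (h : IsVelocity m c) {z : ℝ} (hz : 0 ≤ z) : 0 ≤ passage c z :=
  h.le_passage_iff.2 (by simpa using hz)

lemma image_displacement_Ioc (h : IsVelocity m c) (a b : ℝ) :
    displacement c '' Ioc a b = Ioc (displacement c a) (displacement c b) := by
  refine Subset.antisymm ?_ fun z hz =>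
    ⟨passage c z, ⟨h.lt_passage_iff.2 hz.1, h.passage_le_iff.2 hz.2⟩, h.displacement_passage z⟩
  rintro _ ⟨t, ht, rfl⟩
  exact ⟨h.strictMono_displacement ht.1, h.strictMono_displacement.monotone ht.2⟩

lemma integral_displacement (h : IsVelocity m c) (a b : ℝ) (g : ℝ → ℝ) :
    ∫ z in displacement c a..displacement c b, g z =
      ∫ t in a..b, c t * g (displacement c t) := by
  have on_Ioc (a b : ℝ) : ∫ z in Ioc (displacement c a) (displacement c b), g z =
      ∫ t in Ioc a b, c t * g (displacement c t) := by
    rw [← h.image_displacement_Ioc]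
    simpa using integral_image_eq_integral_deriv_smul_of_monotoneOn measurableSet_Ioc
      (fun t _ => (h.hasDerivAt_displacement t).hasDerivWithinAt)
      (h.strictMono_displacement.monotone.monotoneOn (Ioc a b)) g
  simp only [intervalIntegral, on_Ioc]

section Comparison

variable {m₁ m₂ s t x : ℝ} {c₁ c₂ : ℝ → ℝ}

lemma abs_displacement_sub_le (h₁ : IsVelocity m₁ c₁) (h₂ : IsVelocity m₂ c₂) (hs : 0 ≤ s)
    (hst : s ≤ t) :
    |displacement c₁ s - displacement c₂ s| ≤ ∫ r in (0 : ℝ)..t, |c₁ r - c₂ r| := by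
  have hc : Continuous fun r => |c₁ r - c₂ r| := (h₁.continuous.sub h₂.continuous).abs
  calc |displacement c₁ s - displacement c₂ s|
      = |∫ r in (0 : ℝ)..s, (c₁ r - c₂ r)| := by
        rw [displacement, displacement, intervalIntegral.integral_sub
          (h₁.continuous.intervalIntegrable _ _) (h₂.continuous.intervalIntegrable _ _)]
    _ ≤ ∫ r in (0 : ℝ)..s, |c₁ r - c₂ r| := intervalIntegral.abs_integral_le_integral_abs hs
    _ ≤ ∫ r in (0 : ℝ)..t, |c₁ r - c₂ r| :=
        intervalIntegral.integral_mono_interval le_rfl hs hst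
          (Filter.Eventually.of_forall fun r => abs_nonneg _) (hc.intervalIntegrable _ _)

lemma mul_abs_passage_sub_le (h₁ : IsVelocity m₁ c₁) (h₂ : IsVelocity m₂ c₂) (ht : 0 ≤ t)
    (hx : 0 ≤ x) :
    m₁ * |passage c₁ (max (displacement c₁ t - x) 0) - passage c₂ (max (displacement c₂ t - x) 0)|
      ≤ 2 * ∫ r in (0 : ℝ)..t, |c₁ r - c₂ r| := by
  set s₁ := passage c₁ (max (displacement c₁ t - x) 0)
  set s₂ := passage c₂ (max (displacement c₂ t - x) 0)
  have e₁ : displacement c₁ s₁ = max (displacement c₁ t - x) 0 := h₁.displacement_passage _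
  have e₂ : displacement c₂ s₂ = max (displacement c₂ t - x) 0 := h₂.displacement_passage _
  have s₂_nonneg : 0 ≤ s₂ := h₂.passage_nonneg (le_max_right _ _)
  have s₂_le : s₂ ≤ t :=
    h₂.passage_le_iff.2 (max_le (by linarith) (h₂.displacement_nonneg ht))
  calc m₁ * |s₁ - s₂| ≤ |displacement c₁ s₁ - displacement c₁ s₂| := h₁.mul_abs_sub_le _ _
    _ ≤ |displacement c₁ s₁ - displacement c₂ s₂| + |displacement c₂ s₂ - displacement c₁ s₂| :=
        abs_sub_le _ _ _
    _ ≤ |displacement c₁ t - displacement c₂ t| + |displacement c₁ s₂ - displacement c₂ s₂| := by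
        refine add_le_add ?_ (abs_sub_comm _ _).le
        rw [e₁, e₂]
        simpa using abs_max_sub_max_le_abs (displacement c₁ t - x) (displacement c₂ t - x) 0
    _ ≤ 2 * ∫ r in (0 : ℝ)..t, |c₁ r - c₂ r| := by
        linarith [h₁.abs_displacement_sub_le h₂ ht le_rfl,
          h₁.abs_displacement_sub_le h₂ s₂_nonneg s₂_le]

end Comparison

end IsVelocity

/-! ### Transported data and their load -/

/-- A function on the real line which is bounded by `B`, non-negative and zero outside `I`: a
representative, defined everywhere, of an element of `L^∞(I; ℝ_{≥0})`. -/
structure IsBoundedNonneg (I : Set ℝ) (B : ℝ) (f : ℝ → ℝ) : Prop where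
  measurable : Measurable f
  nonneg : ∀ x, 0 ≤ f x
  le : ∀ x, f x ≤ B
  eq_zero : ∀ x ∉ I, f x = 0

namespace IsBoundedNonneg

variable {I : Set ℝ} {B : ℝ} {f : ℝ → ℝ}

lemma bound_nonneg (h : IsBoundedNonneg I B f) : 0 ≤ B := (h.nonneg 0).trans (h.le 0)

lemma norm_le (h : IsBoundedNonneg I B f) (x : ℝ) : ‖f x‖ ≤ B := by
  rw [Real.norm_of_nonneg (h.nonneg x)]
  exact h.le x

lemma sum {K : Type*} [Fintype K] {B : K → ℝ} {f : K → ℝ → ℝ}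
    (h : ∀ k, IsBoundedNonneg I (B k) (f k)) :
    IsBoundedNonneg I (∑ k, B k) fun x => ∑ k, f k x where
  measurable := Finset.measurable_fun_sum _ fun k _ => (h k).measurable
  nonneg x := Finset.sum_nonneg fun k _ => (h k).nonneg x
  le x := Finset.sum_le_sum fun k _ => (h k).le x
  eq_zero x hx := Finset.sum_eq_zero fun k _ => (h k).eq_zero x hx

lemma intervalIntegrable (h : IsBoundedNonneg I B f) (a b : ℝ) :
    IntervalIntegrable f volume a b :=
  (intervalIntegrable_const (c := B)).mono_fun h.measurable.aestronglyMeasurable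
    (.of_forall fun x => (h.norm_le x).trans (le_abs_self B))

lemma memLp {a b : ℝ} (h : IsBoundedNonneg (Icc a b) B f) (p : ℝ≥0∞) : MemLp f p volume := by
  have supported : f = (Icc a b).indicator f :=
    (indicator_eq_self.2 fun x hx => not_not.1 fun h' => hx (h.eq_zero x h')).symm
  rw [supported, memLp_indicator_iff_restrict measurableSet_Icc]
  exact MemLp.of_bound h.measurable.aestronglyMeasurable B (.of_forall h.norm_le)

lemma abs_integral_le (h : IsBoundedNonneg I B f) (a b : ℝ) : |∫ x in a..b, f x| ≤ B * |b - a| :=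
  intervalIntegral.norm_integral_le_of_norm_le_const fun x _ => h.norm_le x

end IsBoundedNonneg

lemma IsNonnegLinfty.exists_isBoundedNonneg_ae_eq {I : Set ℝ} {f : ℝ → ℝ}
    (h : IsNonnegLinfty I f) (hI : MeasurableSet I) :
    ∃ B g, IsBoundedNonneg I B g ∧ g =ᵐ[volume.restrict I] f := by
  have le_bound : ∀ᵐ x ∂volume.restrict I, f x ≤ (eLpNorm f ∞ (volume.restrict I)).toReal := by
    filter_upwards [ae_le_eLpNormEssSup (f := f) (μ := volume.restrict I)] with x hx
    rw [← eLpNorm_exponent_top] at hx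
    exact (le_abs_self _).trans (by simpa using ENNReal.toReal_mono h.1.2.ne hx)
  set B := (eLpNorm f ∞ (volume.restrict I)).toReal
  have hB : 0 ≤ B := ENNReal.toReal_nonneg
  refine ⟨B, I.indicator fun x => max 0 (min B (h.1.1.mk f x)),
    ⟨?_, fun x => indicator_nonneg (fun x _ => le_max_left _ _) x, ?_,
      fun x hx => indicator_of_notMem hx _⟩, ?_⟩
  · exact (measurable_const.max
      (measurable_const.min h.1.1.stronglyMeasurable_mk.measurable)).indicator hI
  · exact fun x => indicator_apply_le' (fun _ => max_le hB (min_le_left _ _)) fun _ => hB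
  · filter_upwards [h.1.1.ae_eq_mk, h.2, le_bound, ae_restrict_mem hI] with x hx h0 hle hxI
    rw [indicator_of_mem hxI, ← hx, min_eq_right hle, max_eq_right h0]

/-- The density in the coordinate `z = x - displacement c t` moving with the velocity `c`, caused by
the initial density `r` and the inflow `u`: at time `t` the density at `x` is
`profile c r u (x - displacement c t)`. What is found at `z ≤ 0` has entered at `x = 0` at the time
`passage c (-z)`. -/
noncomputable def profile (c r u : ℝ → ℝ) (z : ℝ) : ℝ :=
  if 0 < z then r z else u (passage c (-z)) / c (passage c (-z))

/-- A primitive of `profile c r u`: the mass initially found between `0` and `z` if `0 ≤ z`, and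
minus the mass which enters before the time `passage c (-z)` if `z ≤ 0`. -/
noncomputable def cumulativeMass (c r u : ℝ → ℝ) (z : ℝ) : ℝ :=
  (∫ x in (0 : ℝ)..max z 0, r x) - ∫ s in (0 : ℝ)..passage c (max (-z) 0), u s

/-- The mass found between the positions `b` and `d` at time `t` when everything moves with the
velocity `c`. -/
noncomputable def load (c r u : ℝ → ℝ) (b d t : ℝ) : ℝ :=
  ∫ x in b..d, profile c r u (x - displacement c t)

lemma profile_of_pos {c r u : ℝ → ℝ} {z : ℝ} (hz : 0 < z) : profile c r u z = r z := if_pos hz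

lemma profile_of_nonpos {c r u : ℝ → ℝ} {z : ℝ} (hz : z ≤ 0) :
    profile c r u z = u (passage c (-z)) / c (passage c (-z)) := if_neg hz.not_gt

lemma profile_sum {K : Type*} [Fintype K] (c : ℝ → ℝ) (r u : K → ℝ → ℝ) (z : ℝ) :
    profile c (fun x => ∑ k, r k x) (fun t => ∑ k, u k t) z = ∑ k, profile c (r k) (u k) z := by
  rcases lt_or_ge 0 z with hz | hz
  · simp only [profile_of_pos hz]
  · simp only [profile_of_nonpos hz, Finset.sum_div]

namespace IsVelocity

variable {m : ℝ} {c : ℝ → ℝ} {A B T : ℝ} {r u : ℝ → ℝ}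

lemma mul_profile_neg_displacement (h : IsVelocity m c) (r u : ℝ → ℝ) {t : ℝ} (ht : 0 ≤ t) :
    c t * profile c r u (-displacement c t) = u t := by
  rw [profile_of_nonpos (neg_nonpos.2 (h.displacement_nonneg ht)), neg_neg, h.passage_displacement,
    mul_div_cancel₀ _ (h.velocity_pos t).ne']

lemma isBoundedNonneg_profile (h : IsVelocity m c) (hT : 0 ≤ T)
    (hr : IsBoundedNonneg (Ioo 0 1) A r) (hu : IsBoundedNonneg (Ioo 0 T) B u) :
    IsBoundedNonneg (Icc (-displacement c T) 1) (A + B / m) (profile c r u) where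
  measurable :=
    have hP := (h.continuous_passage.comp continuous_neg).measurable
    Measurable.ite measurableSet_Ioi hr.measurable
      ((hu.measurable.comp hP).div (h.continuous.measurable.comp hP))
  nonneg z := by
    unfold profile
    split_ifs
    exacts [hr.nonneg z, div_nonneg (hu.nonneg _) (h.velocity_pos _).le]
  le z := by
    unfold profile
    split_ifs
    · exact (hr.le z).trans (le_add_of_nonneg_right (div_nonneg hu.bound_nonneg h.pos.le))
    · exact (div_le_div₀ hu.bound_nonneg (hu.le _) h.pos (h.lower _)).trans
        (le_add_of_nonneg_left hr.bound_nonneg)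
  eq_zero z hz := by
    rcases lt_or_ge 0 z with hz0 | hz0
    · rw [profile_of_pos hz0]
      exact hr.eq_zero z fun hz' => hz ⟨by linarith [h.displacement_nonneg hT], hz'.2.le⟩
    · rw [profile_of_nonpos hz0, hu.eq_zero, zero_div]
      rintro ⟨-, hlt⟩
      exact hz ⟨by linarith [h.passage_le_iff.1 hlt.le], hz0.trans zero_le_one⟩

lemma integral_profile_eq_cumulativeMass (h : IsVelocity m c) (r u : ℝ → ℝ) (z : ℝ) :
    ∫ x in (0 : ℝ)..z, profile c r u x = cumulativeMass c r u z := by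
  have passage_zero : passage c 0 = 0 := by simpa using h.passage_displacement 0
  rcases le_total 0 z with hz | hz
  · rw [cumulativeMass, max_eq_left hz, max_eq_right (neg_nonpos.2 hz), passage_zero,
      intervalIntegral.integral_same, sub_zero]
    refine intervalIntegral.integral_congr_ae (.of_forall fun x hx => profile_of_pos ?_)
    rw [uIoc_of_le hz] at hx
    exact hx.1
  · rw [cumulativeMass, max_eq_right hz, max_eq_left (neg_nonneg.2 hz),
      intervalIntegral.integral_same, zero_sub, intervalIntegral.integral_symm, neg_inj]
    have entered := h.integral_displacement 0 (passage c (-z)) fun w => profile c r u (-w)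
    rw [intervalIntegral.integral_comp_neg fun x => profile c r u x, h.displacement_passage,
      displacement_zero, neg_neg, neg_zero] at entered
    rw [entered]
    refine intervalIntegral.integral_congr fun s hs => ?_
    rw [uIcc_of_le (h.passage_nonneg (neg_nonneg.2 hz))] at hs
    exact h.mul_profile_neg_displacement r u hs.1

lemma load_eq (h : IsVelocity m c) (hT : 0 ≤ T) (hr : IsBoundedNonneg (Ioo 0 1) A r)
    (hu : IsBoundedNonneg (Ioo 0 T) B u) (b d t : ℝ) :
    load c r u b d t = cumulativeMass c r u (d - displacement c t) -
      cumulativeMass c r u (b - displacement c t) := by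
  have hint := (h.isBoundedNonneg_profile hT hr hu).intervalIntegrable
  rw [load, intervalIntegral.integral_comp_sub_right (profile c r u),
    ← h.integral_profile_eq_cumulativeMass, ← h.integral_profile_eq_cumulativeMass,
    intervalIntegral.integral_interval_sub_left (hint _ _) (hint _ _)]

lemma continuous_load (h : IsVelocity m c) (hT : 0 ≤ T) (hr : IsBoundedNonneg (Ioo 0 1) A r)
    (hu : IsBoundedNonneg (Ioo 0 T) B u) (b d : ℝ) : Continuous (load c r u b d) := by
  have cont_mass : Continuous (cumulativeMass c r u) := by
    rw [← funext (h.integral_profile_eq_cumulativeMass r u)]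
    exact intervalIntegral.continuous_primitive
      (h.isBoundedNonneg_profile hT hr hu).intervalIntegrable 0
  rw [funext (h.load_eq hT hr hu b d)]
  exact (cont_mass.comp (continuous_const.sub h.continuous_displacement)).sub
    (cont_mass.comp (continuous_const.sub h.continuous_displacement))

lemma abs_cumulativeMass_le (h : IsVelocity m c) (hr : IsBoundedNonneg (Ioo 0 1) A r)
    (hu : IsBoundedNonneg (Ioo 0 T) B u) {t x : ℝ} (ht : t ∈ Icc 0 T) (hx : x ∈ Icc (0 : ℝ) 1) :
    |cumulativeMass c r u (x - displacement c t)| ≤ A + B * T := by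
  have hC := h.displacement_nonneg ht.1
  have initial_length : |max (x - displacement c t) 0 - 0| ≤ 1 := by
    rw [sub_zero, abs_of_nonneg (le_max_right _ _)]
    exact max_le (by linarith [hx.2]) zero_le_one
  have entry_time : |passage c (max (-(x - displacement c t)) 0) - 0| ≤ T := by
    rw [sub_zero, abs_of_nonneg (h.passage_nonneg (le_max_right _ _))]
    exact (h.passage_le_iff.2 (max_le (by linarith [hx.1]) hC)).trans ht.2
  calc |cumulativeMass c r u (x - displacement c t)|
      ≤ A * |max (x - displacement c t) 0 - 0| +
          B * |passage c (max (-(x - displacement c t)) 0) - 0| :=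
        (abs_sub _ _).trans (add_le_add (hr.abs_integral_le _ _) (hu.abs_integral_le _ _))
    _ ≤ A * 1 + B * T := add_le_add (mul_le_mul_of_nonneg_left initial_length hr.bound_nonneg)
        (mul_le_mul_of_nonneg_left entry_time hu.bound_nonneg)
    _ = A + B * T := by rw [mul_one]

lemma abs_load_le (h : IsVelocity m c) (hr : IsBoundedNonneg (Ioo 0 1) A r)
    (hu : IsBoundedNonneg (Ioo 0 T) B u) {b d t : ℝ} (ht : t ∈ Icc 0 T)
    (hb : b ∈ Icc (0 : ℝ) 1) (hd : d ∈ Icc (0 : ℝ) 1) :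
    |load c r u b d t| ≤ 2 * (A + B * T) := by
  rw [h.load_eq (ht.1.trans ht.2) hr hu]
  linarith [abs_sub (cumulativeMass c r u (d - displacement c t))
    (cumulativeMass c r u (b - displacement c t)), h.abs_cumulativeMass_le hr hu ht hb,
    h.abs_cumulativeMass_le hr hu ht hd]

variable {m₁ m₂ : ℝ} {c₁ c₂ : ℝ → ℝ}

lemma abs_cumulativeMass_sub_le (h₁ : IsVelocity m₁ c₁) (h₂ : IsVelocity m₂ c₂)
    (hr : IsBoundedNonneg (Ioo 0 1) A r) (hu : IsBoundedNonneg (Ioo 0 T) B u) {t x : ℝ}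
    (ht : 0 ≤ t) (hx : 0 ≤ x) :
    |cumulativeMass c₁ r u (x - displacement c₁ t) - cumulativeMass c₂ r u (x - displacement c₂ t)|
      ≤ (A + 2 * B / m₁) * ∫ s in (0 : ℝ)..t, |c₁ s - c₂ s| := by
  set z₁ := x - displacement c₁ t
  set z₂ := x - displacement c₂ t
  set I := ∫ s in (0 : ℝ)..t, |c₁ s - c₂ s|
  have initial : |max z₁ 0 - max z₂ 0| ≤ I := by
    refine (abs_max_sub_max_le_abs _ _ _).trans ?_
    rw [sub_sub_sub_cancel_left, abs_sub_comm]
    exact h₁.abs_displacement_sub_le h₂ ht le_rfl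
  have entry : |passage c₁ (max (-z₁) 0) - passage c₂ (max (-z₂) 0)| ≤ 2 * I / m₁ := by
    rw [le_div_iff₀' h₁.pos, neg_sub, neg_sub]
    exact h₁.mul_abs_passage_sub_le h₂ ht hx
  calc |cumulativeMass c₁ r u z₁ - cumulativeMass c₂ r u z₂|
      = |(∫ x in max z₂ 0..max z₁ 0, r x) -
          ∫ s in passage c₂ (max (-z₂) 0)..passage c₁ (max (-z₁) 0), u s| := by
        rw [← intervalIntegral.integral_interval_sub_left (hr.intervalIntegrable 0 _)
          (hr.intervalIntegrable 0 _), ← intervalIntegral.integral_interval_sub_left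
          (hu.intervalIntegrable 0 _) (hu.intervalIntegrable 0 _), cumulativeMass, cumulativeMass]
        ring_nf
    _ ≤ A * |max z₁ 0 - max z₂ 0| +
          B * |passage c₁ (max (-z₁) 0) - passage c₂ (max (-z₂) 0)| :=
        (abs_sub _ _).trans (add_le_add (hr.abs_integral_le _ _) (hu.abs_integral_le _ _))
    _ ≤ A * I + B * (2 * I / m₁) := add_le_add (mul_le_mul_of_nonneg_left initial hr.bound_nonneg)
        (mul_le_mul_of_nonneg_left entry hu.bound_nonneg)
    _ = (A + 2 * B / m₁) * I := by ring

lemma abs_load_sub_load_le (h₁ : IsVelocity m₁ c₁) (h₂ : IsVelocity m₂ c₂)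
    (hr : IsBoundedNonneg (Ioo 0 1) A r) (hu : IsBoundedNonneg (Ioo 0 T) B u) {b d t : ℝ}
    (ht : t ∈ Icc 0 T) (hb : 0 ≤ b) (hd : 0 ≤ d) :
    |load c₁ r u b d t - load c₂ r u b d t| ≤
      2 * (A + 2 * B / m₁) * ∫ s in (0 : ℝ)..t, |c₁ s - c₂ s| := by
  have hT := ht.1.trans ht.2
  rw [h₁.load_eq hT hr hu, h₂.load_eq hT hr hu, sub_sub_sub_comm]
  linarith [abs_sub
    (cumulativeMass c₁ r u (d - displacement c₁ t) - cumulativeMass c₂ r u (d - displacement c₂ t))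
    (cumulativeMass c₁ r u (b - displacement c₁ t) - cumulativeMass c₂ r u (b - displacement c₂ t)),
    h₁.abs_cumulativeMass_sub_le h₂ hr hu ht.1 hb, h₁.abs_cumulativeMass_sub_le h₂ hr hu ht.1 hd]

lemma load_congr (h₁ : IsVelocity m₁ c₁) (h₂ : IsVelocity m₂ c₂)
    (hr : IsBoundedNonneg (Ioo 0 1) A r) (hu : IsBoundedNonneg (Ioo 0 T) B u) {b d t : ℝ}
    (hc : EqOn c₁ c₂ (Icc 0 T)) (ht : t ∈ Icc 0 T) (hb : 0 ≤ b) (hd : 0 ≤ d) :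
    load c₁ r u b d t = load c₂ r u b d t := by
  have integral_zero : ∫ s in (0 : ℝ)..t, |c₁ s - c₂ s| = 0 :=
    intervalIntegral.integral_zero_ae (.of_forall fun s hs => by
      rw [uIoc_of_le ht.1] at hs
      rw [hc ⟨hs.1.le, hs.2.trans ht.2⟩, sub_self, abs_zero])
  have := h₁.abs_load_sub_load_le h₂ hr hu ht hb hd
  rw [integral_zero, mul_zero] at this
  exact sub_eq_zero.1 (abs_nonpos_iff.1 this)

end IsVelocity

/-! ### The self-consistent velocity -/

section Volterra

open scoped Nat

variable {E : Type*} [NormedAddCommGroup E] {a b Q : ℝ}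

lemma norm_iterate_sub_le_of_volterra (hab : a ≤ b) (hQ : 0 ≤ Q) {Φ : C(Icc a b, E) → C(Icc a b, E)}
    (hΦ : ∀ f g (t : Icc a b),
      ‖Φ f t - Φ g t‖ ≤ Q * ∫ s in a..t, ‖f (projIcc a b hab s) - g (projIcc a b hab s)‖)
    (n : ℕ) (f g : C(Icc a b, E)) (t : Icc a b) :
    ‖Φ^[n] f t - Φ^[n] g t‖ ≤ (Q * (t - a)) ^ n / n ! * dist f g := by
  induction n generalizing t with
  | zero => simpa [dist_eq_norm] using ContinuousMap.dist_apply_le_dist (f := f) (g := g) t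
  | succ n ih =>
    have primitive : ∫ s in a..t, (Q * (s - a)) ^ n / n ! * dist f g =
        Q ^ n * (t - a) ^ (n + 1) / (n + 1)! * dist f g := by
      simp only [mul_pow, mul_div_assoc]
      rw [intervalIntegral.integral_mul_const, intervalIntegral.integral_const_mul,
        intervalIntegral.integral_div, intervalIntegral.integral_comp_sub_right (· ^ n),
        integral_pow, sub_self, Nat.factorial_succ]
      push_cast
      field_simp
      simp
    rw [Function.iterate_succ_apply', Function.iterate_succ_apply']
    calc ‖Φ (Φ^[n] f) t - Φ (Φ^[n] g) t‖
        ≤ Q * ∫ s in a..t, ‖Φ^[n] f (projIcc a b hab s) - Φ^[n] g (projIcc a b hab s)‖ :=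
          hΦ _ _ t
      _ ≤ Q * ∫ s in a..t, (Q * (s - a)) ^ n / n ! * dist f g := by
          refine mul_le_mul_of_nonneg_left (intervalIntegral.integral_mono_on t.2.1
            (Continuous.intervalIntegrable (by fun_prop) _ _)
            (Continuous.intervalIntegrable (by fun_prop) _ _) fun s hs => ?_) hQ
          have hs' : s ∈ Icc a b := ⟨hs.1, hs.2.trans t.2.2⟩
          simpa only [projIcc_of_mem hab hs'] using ih ⟨s, hs'⟩
      _ = (Q * (t - a)) ^ (n + 1) / (n + 1)! * dist f g := by rw [primitive, mul_pow]; ring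

theorem existsUnique_fixedPoint_of_volterra [CompleteSpace E] (hab : a ≤ b) (hQ : 0 ≤ Q)
    {Φ : C(Icc a b, E) → C(Icc a b, E)}
    (hΦ : ∀ f g (t : Icc a b),
      ‖Φ f t - Φ g t‖ ≤ Q * ∫ s in a..t, ‖f (projIcc a b hab s) - g (projIcc a b hab s)‖) :
    ∃! f, Φ f = f := by
  obtain ⟨n, hn⟩ := ((FloorSemiring.tendsto_pow_div_factorial_atTop (Q * (b - a))).eventually
    (gt_mem_nhds zero_lt_one)).exists
  have contracting : ContractingWith (((Q * (b - a)) ^ n / n !).toNNReal) Φ^[n] := by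
    refine ⟨Real.toNNReal_lt_one.2 hn, LipschitzWith.of_dist_le_mul fun f g =>
      (ContinuousMap.dist_le (by positivity)).2 fun t => ?_⟩
    rw [dist_eq_norm]
    refine (norm_iterate_sub_le_of_volterra hab hQ hΦ n f g t).trans
      (mul_le_mul_of_nonneg_right ((?_ : _ ≤ _).trans (Real.le_coe_toNNReal _)) dist_nonneg)
    have hat : 0 ≤ (t : ℝ) - a := sub_nonneg.2 t.2.1
    have htb : (t : ℝ) ≤ b := t.2.2
    gcongr
  exact ⟨_, contracting.isFixedPt_fixedPoint_iterate, fun f hf =>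
    contracting.fixedPoint_unique (Function.IsFixedPt.iterate hf n)⟩

end Volterra

/-- A positive velocity `lam t w`, prescribed for times `t ∈ [0, T]` and loads `w`, which is locally
Lipschitz in the load, uniformly in time. -/
structure IsVelocityLaw (T : ℝ) (lam : ℝ → ℝ → ℝ) : Prop where
  continuousOn : ContinuousOn (Function.uncurry lam) (Icc 0 T ×ˢ univ)
  pos : ∀ t ∈ Icc 0 T, ∀ w, 0 < lam t w
  lipschitz : ∀ W, ∃ L, ∀ t ∈ Icc 0 T, LipschitzOnWith L (lam t) (Icc (-W) W)

namespace IsVelocityLaw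

variable {T : ℝ} {lam : ℝ → ℝ → ℝ}

lemma of_contDiffOn (h : ContDiffOn ℝ 1 (Function.uncurry lam) (Icc 0 T ×ˢ univ))
    (hpos : ∀ t ∈ Icc 0 T, ∀ w, 0 < lam t w) : IsVelocityLaw T lam where
  continuousOn := h.continuousOn
  pos := hpos
  lipschitz W := by
    have locally_lipschitz : LocallyLipschitzOn (Icc 0 T ×ˢ Icc (-W) W) (Function.uncurry lam) :=
      fun x hx => ((h.mono (prod_mono_right (subset_univ _))) x hx).exists_lipschitzOnWith
        ((convex_Icc _ _).prod (convex_Icc _ _))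
    obtain ⟨L, hL⟩ := locally_lipschitz.exists_lipschitzOnWith_of_compact
      (isCompact_Icc.prod isCompact_Icc)
    refine ⟨L, fun t ht => ?_⟩
    simpa [Function.comp_def] using hL.comp (LipschitzWith.prodMk_left t).lipschitzOnWith
      fun w hw => ⟨ht, hw⟩

lemma continuousOn_comp (h : IsVelocityLaw T lam) {w : ℝ → ℝ} (hw : ContinuousOn w (Icc 0 T)) :
    ContinuousOn (fun t => lam t (w t)) (Icc 0 T) :=
  h.continuousOn.comp (continuousOn_id.prodMk hw) fun _ ht => ⟨ht, mem_univ _⟩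

lemma exists_pos_le (h : IsVelocityLaw T lam) (hT : 0 ≤ T) {W : ℝ} (hW : 0 ≤ W) :
    ∃ m > 0, ∀ t ∈ Icc 0 T, ∀ w ∈ Icc (-W) W, m ≤ lam t w := by
  obtain ⟨q, hq, hmin⟩ := (isCompact_Icc.prod isCompact_Icc).exists_isMinOn
    ⟨((0 : ℝ), (0 : ℝ)), ⟨left_mem_Icc.2 hT, neg_nonpos.2 hW, hW⟩⟩
    (h.continuousOn.mono (prod_mono_right (subset_univ (Icc (-W) W))))
  exact ⟨_, h.pos q.1 hq.1 q.2, fun t ht w hw =>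
    isMinOn_iff.1 hmin (t, w) ⟨ht, hw⟩⟩

end IsVelocityLaw

/-- On `[0, T]`, the velocity `c` is the one prescribed by the law `lam` for the load between `b`
and `d` which results from moving the initial density `r` and the inflow `u` with velocity `c`. -/
def IsSelfConsistent (T : ℝ) (lam : ℝ → ℝ → ℝ) (b d : ℝ) (r u c : ℝ → ℝ) : Prop :=
  ∀ t ∈ Icc 0 T, c t = lam t (load c r u b d t)

section SelfConsistent

variable {T A B b d : ℝ} {lam : ℝ → ℝ → ℝ} {r u : ℝ → ℝ}

/-- A velocity on `[0, T]`, extended to a velocity in the sense of `IsVelocity`. The truncation from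
below by `m` does not change the velocities of interest. -/
noncomputable def extendVelocity (hT : 0 ≤ T) (m : ℝ) (f : C(Icc 0 T, ℝ)) (t : ℝ) : ℝ :=
  max m (f (projIcc 0 T hT t))

lemma isVelocity_extendVelocity (hT : 0 ≤ T) {m : ℝ} (hm : 0 < m) (f : C(Icc 0 T, ℝ)) :
    IsVelocity m (extendVelocity hT m f) :=
  ⟨hm, by unfold extendVelocity; fun_prop, fun _ => le_max_left _ _⟩

lemma extendVelocity_of_mem (hT : 0 ≤ T) {m t : ℝ} {f : C(Icc 0 T, ℝ)} (ht : t ∈ Icc 0 T)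
    (hf : m ≤ f ⟨t, ht⟩) : extendVelocity hT m f t = f ⟨t, ht⟩ := by
  rw [extendVelocity, projIcc_of_mem hT ht, max_eq_right hf]

lemma integral_abs_extendVelocity_sub_le (hT : 0 ≤ T) (m : ℝ) (f g : C(Icc 0 T, ℝ)) {t : ℝ}
    (ht : 0 ≤ t) :
    ∫ s in (0 : ℝ)..t, |extendVelocity hT m f s - extendVelocity hT m g s| ≤
      ∫ s in (0 : ℝ)..t, ‖f (projIcc 0 T hT s) - g (projIcc 0 T hT s)‖ := by
  refine intervalIntegral.integral_mono_on ht (Continuous.intervalIntegrable ?_ _ _)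
    (Continuous.intervalIntegrable (by fun_prop) _ _) fun s _ =>
      abs_max_sub_max_le_max m _ m _ |>.trans ?_
  · unfold extendVelocity; fun_prop
  · simp

lemma IsVelocityLaw.exists_pos_le_load (h : IsVelocityLaw T lam) (hT : 0 ≤ T)
    (hr : IsBoundedNonneg (Ioo 0 1) A r) (hu : IsBoundedNonneg (Ioo 0 T) B u)
    (hb : b ∈ Icc (0 : ℝ) 1) (hd : d ∈ Icc (0 : ℝ) 1) :
    ∃ m > 0, ∀ m' c, IsVelocity m' c → ∀ t ∈ Icc 0 T, m ≤ lam t (load c r u b d t) := by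
  have bound_nonneg : 0 ≤ 2 * (A + B * T) := by
    linarith [hr.bound_nonneg, mul_nonneg hu.bound_nonneg hT]
  obtain ⟨m, hm, hle⟩ := h.exists_pos_le hT bound_nonneg
  exact ⟨m, hm, fun m' c hc t ht => hle t ht _ (abs_le.1 (hc.abs_load_le hr hu ht hb hd))⟩

lemma IsVelocityLaw.exists_abs_sub_load_le (h : IsVelocityLaw T lam)
    (hr : IsBoundedNonneg (Ioo 0 1) A r) (hu : IsBoundedNonneg (Ioo 0 T) B u)
    (hb : b ∈ Icc (0 : ℝ) 1) (hd : d ∈ Icc (0 : ℝ) 1) {m : ℝ} (hm : 0 < m) :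
    ∃ Q ≥ 0, ∀ c₁ c₂, IsVelocity m c₁ → IsVelocity m c₂ → ∀ t ∈ Icc 0 T,
      |lam t (load c₁ r u b d t) - lam t (load c₂ r u b d t)| ≤
        Q * ∫ s in (0 : ℝ)..t, |c₁ s - c₂ s| := by
  have := hr.bound_nonneg
  have := hu.bound_nonneg
  obtain ⟨L, hL⟩ := h.lipschitz (2 * (A + B * T))
  refine ⟨L * (2 * (A + 2 * B / m)), by positivity, fun c₁ c₂ h₁ h₂ t ht => ?_⟩
  rw [mul_assoc]
  exact ((hL t ht).norm_sub_le (abs_le.1 (h₁.abs_load_le hr hu ht hb hd))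
    (abs_le.1 (h₂.abs_load_le hr hu ht hb hd))).trans
      (mul_le_mul_of_nonneg_left (h₁.abs_load_sub_load_le h₂ hr hu ht hb.1 hd.1) L.2)

theorem IsVelocityLaw.exists_isSelfConsistent (h : IsVelocityLaw T lam) (hT : 0 ≤ T)
    (hr : IsBoundedNonneg (Ioo 0 1) A r) (hu : IsBoundedNonneg (Ioo 0 T) B u)
    (hb : b ∈ Icc (0 : ℝ) 1) (hd : d ∈ Icc (0 : ℝ) 1) :
    ∃ m c, IsVelocity m c ∧ IsSelfConsistent T lam b d r u c ∧
      ∀ m' c', IsVelocity m' c' → IsSelfConsistent T lam b d r u c' → EqOn c' c (Icc 0 T) := by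
  obtain ⟨m, hm, le_lam⟩ := h.exists_pos_le_load hT hr hu hb hd
  obtain ⟨Q, hQ, hlip⟩ := h.exists_abs_sub_load_le hr hu hb hd hm
  have hv := isVelocity_extendVelocity hT hm
  let Φ (f : C(Icc 0 T, ℝ)) : C(Icc 0 T, ℝ) :=
    ⟨(Icc 0 T).domRestrict fun t => lam t (load (extendVelocity hT m f) r u b d t),
      (h.continuousOn_comp ((hv f).continuous_load hT hr hu b d).continuousOn).domRestrict⟩
  obtain ⟨f, hf, unique⟩ := existsUnique_fixedPoint_of_volterra (Φ := Φ) hT hQ fun f g t =>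
    (hlip _ _ (hv f) (hv g) t t.2).trans
      (mul_le_mul_of_nonneg_left (integral_abs_extendVelocity_sub_le hT m f g t.2.1) hQ)
  have f_apply (t : ℝ) (ht : t ∈ Icc 0 T) :
      f ⟨t, ht⟩ = lam t (load (extendVelocity hT m f) r u b d t) := by
    conv_lhs => rw [← hf]
    rfl
  have extend_f (t : ℝ) (ht : t ∈ Icc 0 T) : extendVelocity hT m f t = f ⟨t, ht⟩ :=
    extendVelocity_of_mem hT ht (f_apply t ht ▸ le_lam m _ (hv f) t ht)
  refine ⟨m, extendVelocity hT m f, hv f, fun t ht => (extend_f t ht).trans (f_apply t ht),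
    fun m' c' hc' hself => ?_⟩
  let g : C(Icc 0 T, ℝ) := ⟨(Icc 0 T).domRestrict c', hc'.continuous.continuousOn.domRestrict⟩
  have extend_g : EqOn (extendVelocity hT m g) c' (Icc 0 T) := fun t ht =>
    extendVelocity_of_mem hT ht ((le_lam m' c' hc' t ht).trans_eq (hself t ht).symm)
  have g_eq_f : g = f := unique g <| ContinuousMap.ext fun t => by
    change lam t (load (extendVelocity hT m g) r u b d t) = c' t
    rw [(hv g).load_congr hc' hr hu extend_g t.2 hb.1 hd.1, hself t t.2]
  exact g_eq_f ▸ extend_g.symm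

end SelfConsistent

/-! ### Weak solutions of the transport equation -/

/-- The derivative of `φ (t, x)` along the vector field `∂_t + c(t) ∂_x`, that is, as seen by a
particle moving with velocity `c`. -/
noncomputable def materialDeriv (c : ℝ → ℝ) (φ : ℝ × ℝ → ℝ) (t x : ℝ) : ℝ :=
  fderiv ℝ φ (t, x) (1, 0) + c t * fderiv ℝ φ (t, x) (0, 1)

/-- The time in `[0, T]` at which the particle found at `z + displacement c t` at time `t` passes
the position `ξ`; it is `0` if the particle starts beyond `ξ`, and `T` if it does not reach `ξ`
before the time `T`. -/
noncomputable def arrivalTime (c : ℝ → ℝ) (T ξ z : ℝ) : ℝ := max 0 (min T (passage c (ξ - z)))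

namespace IsVelocity

variable {m T : ℝ} {c g : ℝ → ℝ} {φ : ℝ × ℝ → ℝ}

lemma continuous_materialDeriv (h : IsVelocity m c) (hφ : ContDiff ℝ 1 φ) :
    Continuous fun q : ℝ × ℝ => materialDeriv c φ q.1 q.2 := by
  have := hφ.continuous_fderiv one_ne_zero
  have := h.continuous
  unfold materialDeriv
  fun_prop

lemma hasDerivAt_characteristic (h : IsVelocity m c) (hφ : ContDiff ℝ 1 φ) (z t : ℝ) :
    HasDerivAt (fun s => φ (s, z + displacement c s)) (materialDeriv c φ t (z + displacement c t))
      t := by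
  have curve : HasDerivAt (fun s => (s, z + displacement c s)) ((1 : ℝ), c t) t :=
    (hasDerivAt_id t).prodMk ((h.hasDerivAt_displacement t).const_add z)
  have chain := ((hφ.differentiable one_ne_zero).differentiableAt (x := (t, z + displacement c t))
    |>.hasFDerivAt).comp_hasDerivAt t curve
  have direction : ((1 : ℝ), c t) = (1, 0) + c t • (0, 1) := by simp
  rwa [direction, map_add, map_smul, smul_eq_mul] at chain

lemma integral_materialDeriv (h : IsVelocity m c) (hφ : ContDiff ℝ 1 φ) (z t₁ t₂ : ℝ) :
    ∫ t in t₁..t₂, materialDeriv c φ t (z + displacement c t) =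
      φ (t₂, z + displacement c t₂) - φ (t₁, z + displacement c t₁) :=
  intervalIntegral.integral_eq_sub_of_hasDerivAt (fun t _ => h.hasDerivAt_characteristic hφ z t)
    (((h.continuous_materialDeriv hφ).comp (continuous_id.prodMk
      (continuous_const.add h.continuous_displacement))).intervalIntegrable _ _)

lemma continuous_arrivalTime (h : IsVelocity m c) (T ξ : ℝ) : Continuous (arrivalTime c T ξ) := by
  have := h.continuous_passage
  unfold arrivalTime
  fun_prop

lemma arrivalTime_sub_displacement (h : IsVelocity m c) {t : ℝ} (ht : t ∈ Icc 0 T) (ξ : ℝ) :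
    arrivalTime c T ξ (ξ - displacement c t) = t := by
  rw [arrivalTime, sub_sub_cancel, h.passage_displacement, min_eq_right ht.2, max_eq_right ht.1]

lemma arrivalTime_of_le (h : IsVelocity m c) (hT : 0 ≤ T) {ξ z : ℝ}
    (hz : z ≤ ξ - displacement c T) : arrivalTime c T ξ z = T := by
  rw [arrivalTime, min_eq_left (h.le_passage_iff.2 (by linarith)), max_eq_right hT]

lemma arrivalTime_of_ge (h : IsVelocity m c) {ξ z : ℝ} (hz : ξ ≤ z) :
    arrivalTime c T ξ z = 0 :=
  max_eq_left ((min_le_right _ _).trans (h.passage_le_iff.2 (by simpa using hz)))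

lemma mem_Ioc_arrivalTime_iff (h : IsVelocity m c) {ξ₁ ξ₂ z t : ℝ} :
    t ∈ Ioc (arrivalTime c T ξ₁ z) (arrivalTime c T ξ₂ z) ↔
      t ∈ Ioc 0 T ∧ z + displacement c t ∈ Ioc ξ₁ ξ₂ := by
  have h₁ : passage c (ξ₁ - z) < t ↔ ξ₁ < z + displacement c t := by
    rw [← not_le, h.le_passage_iff, not_le, sub_lt_iff_lt_add']
  have h₂ : t ≤ passage c (ξ₂ - z) ↔ z + displacement c t ≤ ξ₂ := by
    rw [h.le_passage_iff, le_sub_iff_add_le']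
  simp only [arrivalTime, mem_Ioc, max_lt_iff, min_lt_iff, le_max_iff, le_min_iff, ← h₁, ← h₂]
  grind

lemma integral_indicator_materialDeriv (h : IsVelocity m c) (hT : 0 ≤ T) (hφ : ContDiff ℝ 1 φ)
    {ξ₁ ξ₂ : ℝ} (hξ : ξ₁ ≤ ξ₂) (z : ℝ) :
    ∫ t in (0 : ℝ)..T, (Ioc ξ₁ ξ₂).indicator (materialDeriv c φ t) (z + displacement c t) =
      φ (arrivalTime c T ξ₂ z, z + displacement c (arrivalTime c T ξ₂ z)) -
        φ (arrivalTime c T ξ₁ z, z + displacement c (arrivalTime c T ξ₁ z)) := by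
  have arrivals_le : arrivalTime c T ξ₁ z ≤ arrivalTime c T ξ₂ z := by
    unfold arrivalTime
    gcongr
    exact h.passage_le_iff.2 (by rw [h.displacement_passage]; gcongr)
  rw [← h.integral_materialDeriv hφ, intervalIntegral.integral_of_le hT,
    intervalIntegral.integral_of_le arrivals_le, ← integral_indicator measurableSet_Ioc,
    ← integral_indicator measurableSet_Ioc]
  congr 1 with t
  simp only [indicator_apply, h.mem_Ioc_arrivalTime_iff, ite_and]

lemma integral_mul_arrival (h : IsVelocity m c) (hT : 0 ≤ T) (hφ : Continuous φ)
    (hg : ∀ a b, IntervalIntegrable g volume a b) (a b ξ : ℝ) (ha : a ≤ ξ - displacement c T)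
    (hb : ξ ≤ b) :
    ∫ z in a..b, g z * φ (arrivalTime c T ξ z, z + displacement c (arrivalTime c T ξ z)) =
      (∫ z in a..ξ - displacement c T, g z * φ (T, z + displacement c T)) +
        (∫ t in (0 : ℝ)..T, c t * (g (ξ - displacement c t) * φ (t, ξ))) +
        ∫ z in ξ..b, g z * φ (0, z) := by
  set G := fun z => g z * φ (arrivalTime c T ξ z, z + displacement c (arrivalTime c T ξ z))
    with hG
  have integrable_G (a b : ℝ) : IntervalIntegrable G volume a b := by
    have := h.continuous_arrivalTime T ξ
    have := h.continuous_displacement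
    exact (hg a b).mul_continuousOn (by fun_prop)
  rw [← intervalIntegral.integral_add_adjacent_intervals (integrable_G a ξ) (integrable_G ξ b),
    ← intervalIntegral.integral_add_adjacent_intervals (integrable_G a (ξ - displacement c T))
      (integrable_G _ ξ)]
  congr 1
  · congr 1
    · refine intervalIntegral.integral_congr fun z hz => ?_
      rw [uIcc_of_le ha] at hz
      simp only [hG, h.arrivalTime_of_le hT hz.2]
    · have entering := h.integral_displacement 0 T fun w => G (ξ - w)
      rw [intervalIntegral.integral_comp_sub_left G, displacement_zero, sub_zero] at entering
      rw [entering]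
      refine intervalIntegral.integral_congr fun t ht => ?_
      rw [uIcc_of_le hT] at ht
      simp only [hG, h.arrivalTime_sub_displacement ht, sub_add_cancel]
  · refine intervalIntegral.integral_congr fun z hz => ?_
    rw [uIcc_of_le hb] at hz
    simp only [hG, h.arrivalTime_of_ge hz.1, displacement_zero, add_zero]

lemma integral_mul_indicator_comp_add (h : IsVelocity m c) {t : ℝ} (ht : t ∈ Icc 0 T)
    (k : ℝ → ℝ) :
    ∫ z in -displacement c T..1, g z * (Ioc 0 1).indicator k (z + displacement c t) =
      ∫ x in (0 : ℝ)..1, g (x - displacement c t) * k x := by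
  have hC : displacement c t ≤ displacement c T := h.strictMono_displacement.monotone ht.2
  have hC0 := h.displacement_nonneg ht.1
  have := intervalIntegral.integral_comp_sub_right (a := (0 : ℝ)) (b := 1)
    (fun z => g z * k (z + displacement c t)) (displacement c t)
  simp only [sub_add_cancel] at this
  rw [this, intervalIntegral.integral_of_le (by linarith),
    intervalIntegral.integral_of_le (by linarith), ← integral_indicator measurableSet_Ioc,
    ← integral_indicator measurableSet_Ioc]
  congr 1 with z
  simp only [indicator_apply, mem_Ioc]
  grind

lemma integrableOn_mul_indicator_materialDeriv (h : IsVelocity m c) (hφ : ContDiff ℝ 1 φ)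
    {a b : ℝ} (hg : IntegrableOn g (Ioc a b)) (T : ℝ) :
    IntegrableOn (Function.uncurry fun t z =>
      g z * (Ioc 0 1).indicator (materialDeriv c φ t) (z + displacement c t))
      (Ioc 0 T ×ˢ Ioc a b) := by
  obtain ⟨S, hS⟩ := (isCompact_Icc.prod isCompact_Icc).exists_bound_of_continuousOn
    (s := Icc 0 T ×ˢ Icc 0 1) (h.continuous_materialDeriv hφ).continuousOn
  have measurable_inside : MeasurableSet {q : ℝ × ℝ | q.2 + displacement c q.1 ∈ Ioc (0 : ℝ) 1} :=
    (continuous_snd.add (h.continuous_displacement.comp continuous_fst)).measurable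
      measurableSet_Ioc
  have measurable_deriv : Measurable fun q : ℝ × ℝ =>
      (Ioc 0 1).indicator (materialDeriv c φ q.1) (q.2 + displacement c q.1) := by
    refine Measurable.ite measurable_inside (Continuous.measurable ?_) measurable_const
    exact (h.continuous_materialDeriv hφ).comp (continuous_fst.prodMk
      (continuous_snd.add (h.continuous_displacement.comp continuous_fst)))
  rw [IntegrableOn, Measure.volume_eq_prod, ← Measure.prod_restrict]
  refine (Integrable.comp_snd hg _).mul_bdd measurable_deriv.aestronglyMeasurable (c := |S|) ?_
  rw [Measure.prod_restrict]
  refine ae_restrict_of_forall_mem (measurableSet_Ioc.prod measurableSet_Ioc) fun q hq => ?_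
  by_cases hx : q.2 + displacement c q.1 ∈ Ioc (0 : ℝ) 1
  · rw [indicator_of_mem hx]
    exact (hS (q.1, q.2 + displacement c q.1)
      ⟨Ioc_subset_Icc_self hq.1, Ioc_subset_Icc_self hx⟩).trans (le_abs_self S)
  · rw [indicator_of_notMem hx, norm_zero]
    exact abs_nonneg S

theorem integral_mul_materialDeriv (h : IsVelocity m c) (hT : 0 ≤ T)
    (hφ : ContDiff ℝ 1 φ) (hg : ∀ a b, IntervalIntegrable g volume a b) :
    ∫ t in (0 : ℝ)..T, ∫ x in (0 : ℝ)..1, g (x - displacement c t) * materialDeriv c φ t x =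
      (∫ x in (0 : ℝ)..1, g (x - displacement c T) * φ (T, x)) +
        (∫ t in (0 : ℝ)..T, c t * g (1 - displacement c t) * φ (t, 1)) -
        (∫ x in (0 : ℝ)..1, g x * φ (0, x)) -
        ∫ t in (0 : ℝ)..T, c t * g (-displacement c t) * φ (t, 0) := by
  have hC := h.displacement_nonneg hT
  set Z := -displacement c T with hZ
  have integrable_arrival (ξ : ℝ) : IntervalIntegrable (fun z =>
      g z * φ (arrivalTime c T ξ z, z + displacement c (arrivalTime c T ξ z))) volume Z 1 := by
    have := h.continuous_arrivalTime T ξ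
    have := h.continuous_displacement
    have := hφ.continuous
    exact (hg Z 1).mul_continuousOn (by fun_prop)
  have terminal : ∫ z in Z..1 - displacement c T, g z * φ (T, z + displacement c T) =
      ∫ x in (0 : ℝ)..1, g (x - displacement c T) * φ (T, x) := by
    have := intervalIntegral.integral_comp_sub_right (a := (0 : ℝ)) (b := 1)
      (fun z => g z * φ (T, z + displacement c T)) (displacement c T)
    simpa only [sub_add_cancel, zero_sub] using this.symm
  calc _ = ∫ t in (0 : ℝ)..T, ∫ z in Z..1,
        g z * (Ioc 0 1).indicator (materialDeriv c φ t) (z + displacement c t) := by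
        refine intervalIntegral.integral_congr fun t ht => ?_
        rw [uIcc_of_le hT] at ht
        exact (h.integral_mul_indicator_comp_add ht _).symm
    _ = ∫ z in Z..1, ∫ t in (0 : ℝ)..T,
        g z * (Ioc 0 1).indicator (materialDeriv c φ t) (z + displacement c t) := by
        refine intervalIntegral_intervalIntegral_swap ?_
        rw [uIoc_of_le hT, uIoc_of_le (by linarith)]
        exact h.integrableOn_mul_indicator_materialDeriv hφ (hg Z 1).1 T
    _ = (∫ z in Z..1, g z * φ (arrivalTime c T 1 z, z + displacement c (arrivalTime c T 1 z))) -
        ∫ z in Z..1, g z * φ (arrivalTime c T 0 z, z + displacement c (arrivalTime c T 0 z)) := by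
        rw [← intervalIntegral.integral_sub (integrable_arrival 1) (integrable_arrival 0)]
        simp only [intervalIntegral.integral_const_mul,
          h.integral_indicator_materialDeriv hT hφ zero_le_one, mul_sub]
    _ = _ := by
        rw [h.integral_mul_arrival hT hφ.continuous hg Z 1 1 (by linarith) le_rfl,
          h.integral_mul_arrival hT hφ.continuous hg Z 1 0 (by linarith) zero_le_one, terminal]
        simp only [zero_sub, ← hZ, intervalIntegral.integral_same, mul_assoc]
        ring

end IsVelocity

section Pairing

variable {p : ℝ≥0∞} [Fact (1 ≤ p)] {b d : ℝ}

lemma uIoc_subset_Ioc_unit (hb : b ∈ Icc (0 : ℝ) 1) (hd : d ∈ Icc (0 : ℝ) 1) :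
    uIoc b d ⊆ Ioc 0 1 :=
  Ioc_subset_Ioc (le_min hb.1 hd.1) (max_le hb.2 hd.2)

lemma ae_uIoc_of_ae_Ioo_unit (hb : b ∈ Icc (0 : ℝ) 1) (hd : d ∈ Icc (0 : ℝ) 1) {P : ℝ → Prop}
    (h : ∀ᵐ x ∂volume.restrict (Ioo (0 : ℝ) 1), P x) : ∀ᵐ x, x ∈ uIoc b d → P x := by
  rw [restrict_Ioo_eq_restrict_Ioc, ae_restrict_iff' measurableSet_Ioc] at h
  exact h.mono fun x hx hxm => hx (uIoc_subset_Ioc_unit hb hd hxm)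

instance isProbabilityMeasure_restrict_Ioo_unit :
    IsProbabilityMeasure (volume.restrict (Ioo (0 : ℝ) 1)) := ⟨by simp⟩

lemma integrable_lpUnit (F : LpUnit p) : Integrable F (volume.restrict (Ioo (0 : ℝ) 1)) :=
  memLp_one_iff_integrable.1 ((Lp.memLp F).mono_exponent Fact.out)

lemma intervalIntegrable_lpUnit (F : LpUnit p) : IntervalIntegrable F volume 0 1 :=
  (intervalIntegrable_iff_integrableOn_Ioo_of_le zero_le_one).2 (integrable_lpUnit F)

lemma intervalIntegrable_lpUnit_mul (hb : b ∈ Icc (0 : ℝ) 1) (hd : d ∈ Icc (0 : ℝ) 1)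
    (F : LpUnit p) {w : ℝ → ℝ} (hw : ContinuousOn w (Icc 0 1)) :
    IntervalIntegrable (fun x => F x * w x) volume b d :=
  ((intervalIntegrable_lpUnit F).mul_continuousOn (by rwa [uIcc_of_le zero_le_one])).mono_set
    (by rw [uIcc_of_le (zero_le_one' ℝ)]; exact uIcc_subset_Icc hb hd)

lemma integral_norm_lpUnit_le_norm (F : LpUnit p) : ∫ x in (0 : ℝ)..1, ‖F x‖ ≤ ‖F‖ := by
  rw [intervalIntegral.integral_of_le zero_le_one, integral_Ioc_eq_integral_Ioo]
  rw [integral_norm_eq_lintegral_enorm (integrable_lpUnit F).aestronglyMeasurable,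
    ← eLpNorm_one_eq_lintegral_enorm, Lp.norm_def]
  exact ENNReal.toReal_mono (Lp.eLpNorm_ne_top F)
    (eLpNorm_le_eLpNorm_of_exponent_le Fact.out (Lp.aestronglyMeasurable F))

lemma abs_integral_lpUnit_mul_le (hb : b ∈ Icc (0 : ℝ) 1) (hd : d ∈ Icc (0 : ℝ) 1) (F : LpUnit p)
    {w : ℝ → ℝ} {S : ℝ} (hS : ∀ x ∈ Icc (0 : ℝ) 1, |w x| ≤ S) :
    |∫ x in b..d, F x * w x| ≤ S * ‖F‖ := by
  have hS0 : 0 ≤ S := (abs_nonneg _).trans (hS 0 (by simp))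
  have hF := (intervalIntegrable_lpUnit F).norm.const_mul S
  have subset_unit := uIoc_subset_Ioc_unit hb hd
  calc |∫ x in b..d, F x * w x|
      ≤ |∫ x in b..d, S * ‖F x‖| := by
        rw [← Real.norm_eq_abs]
        refine intervalIntegral.norm_integral_le_abs_of_norm_le
          ((ae_restrict_iff' measurableSet_uIoc).2 (.of_forall fun x hx => ?_)) (hF.mono_set ?_)
        · rw [norm_mul, mul_comm]
          exact mul_le_mul_of_nonneg_right (hS x (Ioc_subset_Icc_self (subset_unit hx)))
            (norm_nonneg _)
        · rw [uIcc_of_le (zero_le_one' ℝ)]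
          exact uIcc_subset_Icc hb hd
    _ ≤ |∫ x in (0 : ℝ)..1, S * ‖F x‖| :=
        intervalIntegral.abs_integral_mono_interval (by rwa [uIoc_of_le (zero_le_one' ℝ)])
          (.of_forall fun x => mul_nonneg hS0 (norm_nonneg (F x))) hF
    _ ≤ S * ‖F‖ := by
        rw [intervalIntegral.integral_const_mul, abs_of_nonneg (mul_nonneg hS0
          (intervalIntegral.integral_nonneg zero_le_one fun x _ => norm_nonneg (F x)))]
        exact mul_le_mul_of_nonneg_left (integral_norm_lpUnit_le_norm F) hS0

lemma integral_lpUnit_sub_mul (hb : b ∈ Icc (0 : ℝ) 1) (hd : d ∈ Icc (0 : ℝ) 1) (F G : LpUnit p)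
    {w : ℝ → ℝ} (hw : ContinuousOn w (Icc 0 1)) :
    ∫ x in b..d, (F - G : LpUnit p) x * w x =
      (∫ x in b..d, F x * w x) - ∫ x in b..d, G x * w x := by
  rw [← intervalIntegral.integral_sub (intervalIntegrable_lpUnit_mul hb hd F hw)
    (intervalIntegrable_lpUnit_mul hb hd G hw)]
  refine intervalIntegral.integral_congr_ae (ae_uIoc_of_ae_Ioo_unit hb hd ?_)
  filter_upwards [Lp.coeFn_sub F G] with x hx
  rw [hx, Pi.sub_apply, sub_mul]

lemma continuousOn_integral_lpUnit_mul (hb : b ∈ Icc (0 : ℝ) 1) (hd : d ∈ Icc (0 : ℝ) 1)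
    {I : Set ℝ} (hI : IsCompact I) {r : ℝ → LpUnit p} (hr : ContinuousOn r I) {k : ℝ → ℝ → ℝ}
    (hk : Continuous (Function.uncurry k)) :
    ContinuousOn (fun t => ∫ x in b..d, r t x * k t x) I := by
  obtain ⟨S, hS⟩ := (hI.prod (isCompact_Icc (a := (0 : ℝ)) (b := 1))).exists_bound_of_continuousOn
    hk.continuousOn
  have hkt (t : ℝ) : ContinuousOn (k t) (Icc 0 1) :=
    (hk.comp (by fun_prop : Continuous fun x : ℝ => (t, x))).continuousOn
  intro s hs
  have density_varies : Filter.Tendsto (fun t => ∫ x in b..d, (r t - r s : LpUnit p) x * k t x)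
      (nhdsWithin s I) (nhds 0) := by
    refine squeeze_zero_norm' (a := fun t => S * ‖r t - r s‖) ?_ ?_
    · filter_upwards [self_mem_nhdsWithin] with t ht
      exact abs_integral_lpUnit_mul_le hb hd _ fun x hx => hS (t, x) ⟨ht, hx⟩
    · simpa using ((hr s hs).sub_const (r s)).norm.const_mul S
  have weight_varies : ContinuousWithinAt (fun t => ∫ x in b..d, r s x * k t x) I s := by
    have hF : IntervalIntegrable (r s) volume b d := by
      simpa using intervalIntegrable_lpUnit_mul hb hd (r s) (w := 1) continuousOn_const
    refine intervalIntegral.continuousWithinAt_of_dominated_interval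
      (bound := fun x => |r s x| * S) ?_ ?_ (hF.abs.mul_const S) ?_
    · exact .of_forall fun t =>
        (intervalIntegrable_iff.1
          (intervalIntegrable_lpUnit_mul hb hd (r s) (hkt t))).aestronglyMeasurable
    · filter_upwards [self_mem_nhdsWithin] with t ht
      refine .of_forall fun x hx => ?_
      rw [norm_mul]
      exact mul_le_mul_of_nonneg_left
        (hS (t, x) ⟨ht, Ioc_subset_Icc_self (uIoc_subset_Ioc_unit hb hd hx)⟩) (norm_nonneg _)
    · exact .of_forall fun x _ => (continuous_const.mul
        (hk.comp (by fun_prop : Continuous fun t : ℝ => (t, x)))).continuousWithinAt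
  refine (Filter.Tendsto.congr (fun t => ?_) (density_varies.add weight_varies)).trans_eq
    (by rw [zero_add])
  rw [integral_lpUnit_sub_mul hb hd _ _ (hkt t), sub_add_cancel]

lemma continuousOn_linkVelocity {K : Type*} [Fintype K] {T : ℝ} {lam : ℝ → ℝ → ℝ}
    (hlam : IsVelocityLaw T lam) (hb : b ∈ Icc (0 : ℝ) 1) (hd : d ∈ Icc (0 : ℝ) 1)
    {ρ : K → ℝ → LpUnit p} (hρ : ∀ k, ContinuousOn (ρ k) (Icc 0 T)) :
    ContinuousOn (linkVelocity lam b d ρ) (Icc 0 T) := by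
  have hint (k : K) (t : ℝ) : IntervalIntegrable (ρ k t) volume b d := by
    simpa using intervalIntegrable_lpUnit_mul hb hd (ρ k t) (w := 1) continuousOn_const
  refine hlam.continuousOn_comp ?_
  simp only [intervalIntegral.integral_finsetSum fun k _ => hint k _]
  refine continuousOn_finsetSum _ fun k _ => ?_
  simpa using continuousOn_integral_lpUnit_mul hb hd isCompact_Icc (hρ k) (k := fun _ _ => 1)
    continuous_const

end Pairing

lemma isWeakTransportSolution_iff {p : ℝ≥0∞} {T : ℝ} {c r₀ u y : ℝ → ℝ} {r : ℝ → LpUnit p} :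
    IsWeakTransportSolution T c r₀ u y r ↔
      ∀ φ : ℝ × ℝ → ℝ, ContDiff ℝ 1 φ → (∀ x ∈ Icc (0 : ℝ) 1, φ (T, x) = 0) →
        (∫ t in (0 : ℝ)..T, ∫ x in (0 : ℝ)..1, r t x * materialDeriv c φ t x)
          + (∫ x in (0 : ℝ)..1, r₀ x * φ (0, x))
          + (∫ t in (0 : ℝ)..T, u t * φ (t, 0))
          - (∫ t in (0 : ℝ)..T, y t * φ (t, 1)) = 0 := Iff.rfl

section Advection

variable {p : ℝ≥0∞} [Fact (1 ≤ p)] {f : ℝ → ℝ}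

/-- The restriction to `(0, 1)` of the translate `x ↦ f (x - s)`, as an element of `L^p`. -/
noncomputable def advect (hf : MemLp f p volume) (s : ℝ) : LpUnit p :=
  LpToLpRestrictCLM ℝ ℝ ℝ volume p (Ioo 0 1) (DomAddAct.mk (-s) +ᵥ hf.toLp f)

lemma coeFn_advect (hf : MemLp f p volume) (s : ℝ) :
    advect hf s =ᵐ[volume.restrict (Ioo (0 : ℝ) 1)] fun x => f (x - s) := by
  refine (LpToLpRestrictCLM_coeFn ℝ (Ioo 0 1) _).trans ?_
  rw [DomAddAct.mk_vadd_toLp]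
  refine ae_restrict_of_ae ((MemLp.coeFn_toLp (hf.comp_measurePreserving
    (measurePreserving_vadd (-s) volume))).mono fun x hx => hx.trans ?_)
  simp [sub_eq_add_neg, add_comm]

lemma continuous_advect (hp : p ≠ ∞) (hf : MemLp f p volume) : Continuous (advect hf) := by
  have : Fact (p ≠ ∞) := ⟨hp⟩
  exact (ContinuousLinearMap.continuous _).comp
    ((DomAddAct.continuous_mk.comp continuous_neg).vadd continuous_const)

theorem isWeakTransportSolution_advect {m T A B : ℝ} {c r u : ℝ → ℝ} (hc : IsVelocity m c)
    (hT : 0 ≤ T) (hr : IsBoundedNonneg (Ioo 0 1) A r) (hu : IsBoundedNonneg (Ioo 0 T) B u)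
    (hf : MemLp (profile c r u) p volume) :
    IsWeakTransportSolution T c r u (fun t => c t * profile c r u (1 - displacement c t))
      (fun t => advect hf (displacement c t)) := by
  refine isWeakTransportSolution_iff.2 fun φ hφ hφT => ?_
  have unit_congr {f g : ℝ → ℝ} (h : f =ᵐ[volume.restrict (Ioo (0 : ℝ) 1)] g) :
      ∫ x in (0 : ℝ)..1, f x = ∫ x in (0 : ℝ)..1, g x :=
    intervalIntegral.integral_congr_ae (ae_uIoc_of_ae_Ioo_unit (by simp) (by simp) h)
  have balance := hc.integral_mul_materialDeriv hT hφ
    (hc.isBoundedNonneg_profile hT hr hu).intervalIntegrable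
  have moving : ∫ t in (0 : ℝ)..T, ∫ x in (0 : ℝ)..1,
      advect hf (displacement c t) x * materialDeriv c φ t x =
      ∫ t in (0 : ℝ)..T, ∫ x in (0 : ℝ)..1,
        profile c r u (x - displacement c t) * materialDeriv c φ t x := by
    congr 1 with t
    exact unit_congr ((coeFn_advect hf _).mul .rfl)
  have terminal : ∫ x in (0 : ℝ)..1, profile c r u (x - displacement c T) * φ (T, x) = 0 :=
    intervalIntegral.integral_zero_ae (ae_uIoc_of_ae_Ioo_unit (by simp) (by simp)
      (ae_restrict_of_forall_mem measurableSet_Ioo fun x hx => by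
        rw [hφT x (Ioo_subset_Icc_self hx), mul_zero]))
  have initial : ∫ x in (0 : ℝ)..1, profile c r u x * φ (0, x) =
      ∫ x in (0 : ℝ)..1, r x * φ (0, x) :=
    unit_congr (ae_restrict_of_forall_mem measurableSet_Ioo fun x hx => by
      simp only [profile_of_pos hx.1])
  have inflow : ∫ t in (0 : ℝ)..T, c t * profile c r u (-displacement c t) * φ (t, 0) =
      ∫ t in (0 : ℝ)..T, u t * φ (t, 0) := by
    refine intervalIntegral.integral_congr fun t ht => ?_
    rw [uIcc_of_le hT] at ht
    simp only [hc.mul_profile_neg_displacement r u ht.1]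
  rw [terminal, initial, inflow, ← moving] at balance
  linarith

end Advection

section TransportUniqueness

variable {p : ℝ≥0∞} {m T : ℝ} {c r₀ u y y' : ℝ → ℝ} {r r' : ℝ → LpUnit p}

lemma IsWeakTransportSolution.congr (hT : 0 ≤ T) {c' r₀' u' : ℝ → ℝ}
    (h : IsWeakTransportSolution T c r₀ u y r) (hc : EqOn c c' (Icc 0 T))
    (hr₀ : r₀ =ᵐ[volume.restrict (Ioo 0 1)] r₀') (hu : u =ᵐ[volume.restrict (Ioo 0 T)] u') :
    IsWeakTransportSolution T c' r₀' u' y r := by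
  have interval_congr {b : ℝ} (hb : 0 ≤ b) {f g φ : ℝ → ℝ}
      (hfg : f =ᵐ[volume.restrict (Ioo 0 b)] g) :
      ∫ x in (0 : ℝ)..b, f x * φ x = ∫ x in (0 : ℝ)..b, g x * φ x := by
    rw [intervalIntegral.integral_of_le hb, intervalIntegral.integral_of_le hb,
      integral_Ioc_eq_integral_Ioo, integral_Ioc_eq_integral_Ioo]
    exact integral_congr_ae (hfg.mul .rfl)
  intro φ hφ hφT
  refine Eq.trans ?_ (h φ hφ hφT)
  rw [interval_congr zero_le_one hr₀, interval_congr hT hu]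
  congr 3
  refine intervalIntegral.integral_congr fun t ht => ?_
  rw [uIcc_of_le hT] at ht
  simp only [hc ht]

lemma ae_eq_zero_of_forall_integral_mul_eq_zero {a b : ℝ} {f : ℝ → ℝ} (hab : a ≤ b)
    (hf : IntegrableOn f (Ioo a b))
    (h : ∀ ζ : ℝ → ℝ, ContDiff ℝ 1 ζ → (∀ t ∉ Ioo a b, ζ t = 0) → ∫ t in a..b, f t * ζ t = 0) :
    f =ᵐ[volume.restrict (Ioo a b)] 0 := by
  refine (ae_restrict_iff' measurableSet_Ioo).2
    (isOpen_Ioo.ae_eq_zero_of_integral_contDiff_smul_eq_zero hf.locallyIntegrableOn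
      fun ζ hζ _ hsupp => ?_)
  have hζ0 (t : ℝ) (ht : t ∉ Ioo a b) : ζ t = 0 :=
    image_eq_zero_of_notMem_tsupport fun hm => ht (hsupp hm)
  rw [← h ζ (hζ.of_le (by simp)) hζ0, intervalIntegral.integral_of_le hab,
    integral_Ioc_eq_integral_Ioo, ← setIntegral_eq_integral_of_forall_compl_eq_zero (s := Ioo a b)]
  · simp only [smul_eq_mul, mul_comm]
  · intro t ht
    rw [hζ0 t ht, zero_smul]

lemma IsWeakTransportSolution.outflow_ae_eq_zero (hT : 0 ≤ T) (hy : IntegrableOn y (Ioo 0 T))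
    (hr : EqOn r 0 (Icc 0 T)) (h : IsWeakTransportSolution T c 0 0 y r) :
    y =ᵐ[volume.restrict (Ioo 0 T)] 0 := by
  refine ae_eq_zero_of_forall_integral_mul_eq_zero hT hy fun ζ hζ hζ0 => ?_
  have tested := h (fun q => ζ q.1) (by fun_prop) fun x _ => hζ0 T (by simp)
  have interior (w : ℝ → ℝ → ℝ) :
      ∫ t in (0 : ℝ)..T, ∫ x in (0 : ℝ)..1, r t x * w t x = 0 := by
    refine intervalIntegral.integral_zero_ae (.of_forall fun t ht => ?_)
    rw [uIoc_of_le hT] at ht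
    rw [hr (Ioc_subset_Icc_self ht)]
    refine intervalIntegral.integral_zero_ae (ae_uIoc_of_ae_Ioo_unit (by simp) (by simp) ?_)
    filter_upwards [Lp.coeFn_zero ℝ p (volume.restrict (Ioo (0 : ℝ) 1))] with x hx
    rw [Pi.zero_apply, hx, Pi.zero_apply, zero_mul]
  rw [interior] at tested
  simpa using tested

variable [Fact (1 ≤ p)]

lemma lpUnit_eq_zero_of_forall_integral_mul_eq_zero {F : LpUnit p}
    (h : ∀ ξ : ℝ → ℝ, ContDiff ℝ 1 ξ → (∀ x ∉ Ioo (0 : ℝ) 1, ξ x = 0) →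
      ∫ x in (0 : ℝ)..1, F x * ξ x = 0) : F = 0 :=
  (Lp.eq_zero_iff_ae_eq_zero).2
    (ae_eq_zero_of_forall_integral_mul_eq_zero zero_le_one (integrable_lpUnit F) h)

lemma exists_contDiff_deriv_eq {ζ : ℝ → ℝ} {t₀ : ℝ} (hζ : Continuous ζ)
    (hζ0 : ∀ t, t₀ ≤ t → ζ t = 0) :
    ∃ η : ℝ → ℝ, ContDiff ℝ 1 η ∧ deriv η = ζ ∧ ∀ t, t₀ ≤ t → η t = 0 := by
  have hη (t : ℝ) : HasDerivAt (fun t => ∫ s in t₀..t, ζ s) (ζ t) t :=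
    intervalIntegral.integral_hasDerivAt_right (hζ.intervalIntegrable _ _)
      (hζ.stronglyMeasurableAtFilter _ _) hζ.continuousAt
  have deriv_eq : deriv (fun t => ∫ s in t₀..t, ζ s) = ζ := funext fun t => (hη t).deriv
  refine ⟨fun t => ∫ s in t₀..t, ζ s, ?_, deriv_eq, fun t ht =>
    intervalIntegral.integral_zero_ae (.of_forall fun s hs => ?_)⟩
  · exact contDiff_one_iff_deriv.2 ⟨fun t => (hη t).differentiableAt, by rwa [deriv_eq]⟩
  · rw [uIoc_of_le ht] at hs
    exact hζ0 s hs.1.le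

lemma IsVelocity.materialDeriv_mul_comp_characteristic (hc : IsVelocity m c) {η k : ℝ → ℝ}
    (hη : ContDiff ℝ 1 η) (hk : ContDiff ℝ 1 k) (t x : ℝ) :
    materialDeriv c (fun q => η q.1 * k (q.2 - displacement c q.1)) t x =
      deriv η t * k (x - displacement c t) := by
  have hC := hc.contDiff_displacement
  have along := hc.hasDerivAt_characteristic (φ := fun q => η q.1 * k (q.2 - displacement c q.1))
    (by fun_prop) (x - displacement c t) t
  simp only [add_sub_cancel_right, sub_add_cancel] at along
  exact along.unique ((hη.differentiable one_ne_zero t).hasDerivAt.mul_const _)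

lemma IsWeakTransportSolution.sub (hc : IsVelocity m c) (hT : 0 ≤ T)
    (hr : ContinuousOn r (Icc 0 T)) (hr' : ContinuousOn r' (Icc 0 T))
    (hy : IntegrableOn y (Ioo 0 T)) (hy' : IntegrableOn y' (Ioo 0 T))
    (h : IsWeakTransportSolution T c r₀ u y r) (h' : IsWeakTransportSolution T c r₀ u y' r') :
    IsWeakTransportSolution T c 0 0 (y - y') (r - r') := by
  refine isWeakTransportSolution_iff.2 fun φ hφ hφT => ?_
  have hD := hc.continuous_materialDeriv hφ
  have interior : ∫ t in (0 : ℝ)..T, ∫ x in (0 : ℝ)..1, (r - r') t x * materialDeriv c φ t x =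
      (∫ t in (0 : ℝ)..T, ∫ x in (0 : ℝ)..1, r t x * materialDeriv c φ t x) -
        ∫ t in (0 : ℝ)..T, ∫ x in (0 : ℝ)..1, r' t x * materialDeriv c φ t x := by
    have pairing_integrable {q : ℝ → LpUnit p} (hq : ContinuousOn q (Icc 0 T)) :
        IntervalIntegrable (fun t => ∫ x in (0 : ℝ)..1, q t x * materialDeriv c φ t x)
          volume 0 T :=
      ContinuousOn.intervalIntegrable_of_Icc hT
        (continuousOn_integral_lpUnit_mul (by simp) (by simp) isCompact_Icc hq hD)
    rw [← intervalIntegral.integral_sub (pairing_integrable hr) (pairing_integrable hr')]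
    congr 1 with t
    exact integral_lpUnit_sub_mul (by simp) (by simp) _ _
      (hD.comp (continuous_const.prodMk continuous_id)).continuousOn
  have outflow : ∫ t in (0 : ℝ)..T, (y - y') t * φ (t, 1) =
      (∫ t in (0 : ℝ)..T, y t * φ (t, 1)) - ∫ t in (0 : ℝ)..T, y' t * φ (t, 1) := by
    have := hφ.continuous
    have trace_integrable {q : ℝ → ℝ} (hq : IntegrableOn q (Ioo 0 T)) :
        IntervalIntegrable (fun t => q t * φ (t, 1)) volume 0 T :=
      ((intervalIntegrable_iff_integrableOn_Ioo_of_le hT).2 hq).mul_continuousOn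
        (by fun_prop : Continuous fun t => φ (t, 1)).continuousOn
    rw [← intervalIntegral.integral_sub (trace_integrable hy) (trace_integrable hy')]
    simp only [Pi.sub_apply, sub_mul]
  have eq := isWeakTransportSolution_iff.1 h φ hφ hφT
  have eq' := isWeakTransportSolution_iff.1 h' φ hφ hφT
  simp only [interior, outflow, Pi.zero_apply, zero_mul, intervalIntegral.integral_zero]
  linarith

lemma IsWeakTransportSolution.integral_mul_comp_characteristic_eq_zero (hc : IsVelocity m c)
    (hr : ContinuousOn r (Icc 0 T)) (h : IsWeakTransportSolution T c 0 0 y r) {t₀ : ℝ}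
    (ht₀ : t₀ ∈ Ioc 0 T) {k : ℝ → ℝ} (hk : ContDiff ℝ 1 k)
    (hk0 : ∀ z, 1 - displacement c t₀ ≤ z → k z = 0) :
    ∫ x in (0 : ℝ)..1, r t₀ x * k (x - displacement c t₀) = 0 := by
  have hC := hc.contDiff_displacement
  set q : ℝ → ℝ := fun t => ∫ x in (0 : ℝ)..1, r t x * k (x - displacement c t)
  have hq : ContinuousOn q (Icc 0 t₀) :=
    continuousOn_integral_lpUnit_mul (by simp) (by simp) isCompact_Icc
      (hr.mono (Icc_subset_Icc_right ht₀.2)) (k := fun t x => k (x - displacement c t))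
      (by have := hk.continuous; have := hC.continuous; fun_prop)
  suffices q_ae_zero : q =ᵐ[volume.restrict (Ioo 0 t₀)] 0 by
    rw [restrict_Ioo_eq_restrict_Icc] at q_ae_zero
    exact Measure.eqOn_Icc_of_ae_eq volume ht₀.1.ne q_ae_zero hq continuousOn_const
      (right_mem_Icc.2 ht₀.1.le)
  refine ae_eq_zero_of_forall_integral_mul_eq_zero ht₀.1.le
    ((hq.integrableOn_Icc).mono_set Ioo_subset_Icc_self) fun ζ hζ hζ0 => ?_
  obtain ⟨η, hη, deriv_η, hη0⟩ := exists_contDiff_deriv_eq (t₀ := t₀) hζ.continuous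
    fun t ht => hζ0 t fun hm => hm.2.not_ge ht
  have no_outflow (t : ℝ) : η t * k (1 - displacement c t) = 0 := by
    rcases le_total t₀ t with ht | ht
    · rw [hη0 t ht, zero_mul]
    · rw [hk0 _ (sub_le_sub_left (hc.strictMono_displacement.monotone ht) 1), mul_zero]
  -- `k (x - displacement c t)` is constant along the characteristics, so the transport operator
  -- only differentiates `η`.
  have tested := isWeakTransportSolution_iff.1 h
    (fun q => η q.1 * k (q.2 - displacement c q.1)) (by fun_prop) fun x _ => by
      rw [hη0 T ht₀.2, zero_mul]
  simp only [hc.materialDeriv_mul_comp_characteristic hη hk, deriv_η, no_outflow, Pi.zero_apply,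
    zero_mul, mul_zero, intervalIntegral.integral_zero, add_zero, sub_zero,
    mul_left_comm _ (ζ _), intervalIntegral.integral_const_mul] at tested
  have support_subset : Function.support (fun t => ζ t * q t) ⊆ Ioc 0 t₀ := fun t ht =>
    Ioo_subset_Ioc_self (not_not.1 fun hm => ht (by simp [hζ0 t hm]))
  simp only [mul_comm (q _)]
  rwa [intervalIntegral.integral_eq_integral_of_support_subset support_subset,
    ← intervalIntegral.integral_eq_integral_of_support_subset
      (support_subset.trans (Ioc_subset_Ioc_right ht₀.2))]

lemma IsWeakTransportSolution.density_eq_zero (hc : IsVelocity m c) (hT : 0 < T)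
    (hr : ContinuousOn r (Icc 0 T)) (h : IsWeakTransportSolution T c 0 0 y r) :
    EqOn r 0 (Icc 0 T) := by
  have zero_of_pos : EqOn r 0 (Ioc 0 T) := fun t ht =>
    lpUnit_eq_zero_of_forall_integral_mul_eq_zero fun ξ hξ hξ0 => by
      simpa using h.integral_mul_comp_characteristic_eq_zero hc hr ht
        (k := fun z => ξ (z + displacement c t)) (by fun_prop)
        fun z hz => hξ0 _ fun hm => by linarith [hm.2]
  exact zero_of_pos.of_subset_closure hr continuousOn_const Ioc_subset_Icc_self
    (closure_Ioc hT.ne).ge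

theorem IsWeakTransportSolution.unique (hc : IsVelocity m c) (hT : 0 < T)
    (hr : ContinuousOn r (Icc 0 T)) (hr' : ContinuousOn r' (Icc 0 T))
    (hy : IntegrableOn y (Ioo 0 T)) (hy' : IntegrableOn y' (Ioo 0 T))
    (h : IsWeakTransportSolution T c r₀ u y r) (h' : IsWeakTransportSolution T c r₀ u y' r') :
    EqOn r r' (Icc 0 T) ∧ y =ᵐ[volume.restrict (Ioo 0 T)] y' := by
  have difference := h.sub hc hT.le hr hr' hy hy' h'
  have density := difference.density_eq_zero hc hT (hr.sub hr')
  exact ⟨fun t ht => sub_eq_zero.1 (density ht),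
    (difference.outflow_ae_eq_zero hT.le (hy.sub hy') density).mono fun t ht => sub_eq_zero.1 ht⟩

end TransportUniqueness

/-! ### A single link -/

lemma IsNonnegLinfty.integrableOn {I : Set ℝ} {f : ℝ → ℝ} (h : IsNonnegLinfty I f)
    (hI : volume I ≠ ∞) : IntegrableOn f I :=
  have : IsFiniteMeasure (volume.restrict I) := isFiniteMeasure_restrict.2 hI
  h.1.integrable le_top

section Link

variable {K : Type*} [Fintype K] {p : ℝ≥0∞} {T b d : ℝ} {lam : ℝ → ℝ → ℝ} {r₀ r₀' u u' : K → ℝ → ℝ}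

/-- `(ρ, y)` (densities and outflows of all commodities) is a weak solution on a single link with
initial densities `r₀` and inflows `u`. The commodities are coupled by their common velocity. -/
structure IsLinkSolution [Fact (1 ≤ p)] (T : ℝ) (lam : ℝ → ℝ → ℝ) (b d : ℝ) (r₀ u : K → ℝ → ℝ)
    (ρ : K → ℝ → LpUnit p) (y : K → ℝ → ℝ) : Prop where
  continuousOn : ∀ k, ContinuousOn (ρ k) (Icc 0 T)
  integrable_outflow : ∀ k, IntegrableOn (y k) (Ioo 0 T)
  weak : ∀ k, IsWeakTransportSolution T (linkVelocity lam b d ρ) (r₀ k) (u k) (y k) (ρ k)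

lemma IsVelocity.isNonnegLinfty_outflow {m A B : ℝ} {c r u : ℝ → ℝ} (hc : IsVelocity m c)
    (hT : 0 ≤ T) (hr : IsBoundedNonneg (Ioo 0 1) A r) (hu : IsBoundedNonneg (Ioo 0 T) B u) :
    IsNonnegLinfty (Ioo 0 T) fun t => c t * profile c r u (1 - displacement c t) := by
  have hg := hc.isBoundedNonneg_profile hT hr hu
  obtain ⟨S, hS⟩ := isCompact_Icc.exists_bound_of_continuousOn (s := Icc 0 T)
    hc.continuous.continuousOn
  refine ⟨memLp_top_of_bound (hc.continuous.measurable.mul (hg.measurable.comp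
    (continuous_const.sub hc.continuous_displacement).measurable)).aestronglyMeasurable
    (S * (A + B / m)) ?_, .of_forall fun t => mul_nonneg (hc.velocity_pos t).le (hg.nonneg _)⟩
  refine ae_restrict_of_forall_mem measurableSet_Ioo fun t ht => ?_
  have hSt := hS t (Ioo_subset_Icc_self ht)
  rw [norm_mul]
  exact mul_le_mul hSt (hg.norm_le _) (norm_nonneg _) ((norm_nonneg _).trans hSt)

variable [Fact (1 ≤ p)] {ρ ρ' : K → ℝ → LpUnit p} {y y' : K → ℝ → ℝ}

lemma IsLinkSolution.congr (h : IsLinkSolution T lam b d r₀ u ρ y) (hT : 0 ≤ T)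
    (hr₀ : ∀ k, r₀ k =ᵐ[volume.restrict (Ioo 0 1)] r₀' k)
    (hu : ∀ k, u k =ᵐ[volume.restrict (Ioo 0 T)] u' k) :
    IsLinkSolution T lam b d r₀' u' ρ y :=
  ⟨h.continuousOn, h.integrable_outflow,
    fun k => (h.weak k).congr hT (eqOn_refl _ _) (hr₀ k) (hu k)⟩

lemma linkVelocity_eq_load {c : ℝ → ℝ} (hb : b ∈ Icc (0 : ℝ) 1) (hd : d ∈ Icc (0 : ℝ) 1)
    (hf : ∀ k, MemLp (profile c (r₀ k) (u k)) p volume) {t : ℝ}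
    (hρ : ∀ k, ρ k t = advect (hf k) (displacement c t)) :
    linkVelocity lam b d ρ t =
      lam t (load c (fun x => ∑ k, r₀ k x) (fun t => ∑ k, u k t) b d t) := by
  refine congrArg (lam t) (intervalIntegral.integral_congr_ae (ae_uIoc_of_ae_Ioo_unit hb hd ?_))
  filter_upwards [ae_all_iff.2 fun k => coeFn_advect (hf k) (displacement c t)] with x hx
  simp only [profile_sum, hρ, hx]

variable {A B : K → ℝ}

lemma exists_isLinkSolution_of_isBoundedNonneg (hp : p ≠ ∞) (hT : 0 ≤ T)
    (hlam : IsVelocityLaw T lam) (hb : b ∈ Icc (0 : ℝ) 1) (hd : d ∈ Icc (0 : ℝ) 1)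
    (hr : ∀ k, IsBoundedNonneg (Ioo 0 1) (A k) (r₀ k))
    (hu : ∀ k, IsBoundedNonneg (Ioo 0 T) (B k) (u k)) :
    ∃ (ρ : K → ℝ → LpUnit p) (y : K → ℝ → ℝ), IsLinkSolution T lam b d r₀ u ρ y ∧
      (∀ k, IsNonnegLinfty (Ioo 0 T) (y k)) ∧
      ∀ k, ∃ M : ℝ, ∀ t, ∀ᵐ x ∂volume.restrict (Ioo (0 : ℝ) 1), 0 ≤ ρ k t x ∧ ρ k t x ≤ M := by
  obtain ⟨m, c, hc, self_consistent, -⟩ := hlam.exists_isSelfConsistent hT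
    (IsBoundedNonneg.sum hr) (IsBoundedNonneg.sum hu) hb hd
  have hg (k : K) := hc.isBoundedNonneg_profile hT (hr k) (hu k)
  have hf (k : K) : MemLp (profile c (r₀ k) (u k)) p volume := (hg k).memLp p
  have hy (k : K) := hc.isNonnegLinfty_outflow hT (hr k) (hu k)
  refine ⟨fun k t => advect (hf k) (displacement c t), _,
    ⟨fun k => ?_, fun k => (hy k).integrableOn (by simp), fun k => ?_⟩, hy,
    fun k => ⟨A k + B k / m, fun t => ?_⟩⟩
  · exact ((continuous_advect hp (hf k)).comp hc.continuous_displacement).continuousOn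
  · exact (isWeakTransportSolution_advect hc hT (hr k) (hu k) (hf k)).congr hT
      (fun t ht => (self_consistent t ht).trans
        (linkVelocity_eq_load hb hd hf fun _ => rfl).symm) .rfl .rfl
  · filter_upwards [coeFn_advect (hf k) (displacement c t)] with x hx
    rw [hx]
    exact ⟨(hg k).nonneg _, (hg k).le _⟩

lemma exists_isLinkSolution (hp : p ≠ ∞) (hT : 0 ≤ T) (hlam : IsVelocityLaw T lam)
    (hb : b ∈ Icc (0 : ℝ) 1) (hd : d ∈ Icc (0 : ℝ) 1)
    (hr₀ : ∀ k, IsNonnegLinfty (Ioo 0 1) (r₀ k)) (hu : ∀ k, IsNonnegLinfty (Ioo 0 T) (u k)) :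
    ∃ (ρ : K → ℝ → LpUnit p) (y : K → ℝ → ℝ), IsLinkSolution T lam b d r₀ u ρ y ∧
      (∀ k, IsNonnegLinfty (Ioo 0 T) (y k)) ∧
      ∀ k, ∃ M : ℝ, ∀ t, ∀ᵐ x ∂volume.restrict (Ioo (0 : ℝ) 1), 0 ≤ ρ k t x ∧ ρ k t x ≤ M := by
  choose A r hr r_eq using fun k => (hr₀ k).exists_isBoundedNonneg_ae_eq measurableSet_Ioo
  choose B v hv v_eq using fun k => (hu k).exists_isBoundedNonneg_ae_eq measurableSet_Ioo
  obtain ⟨ρ, y, solution, bounds⟩ :=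
    exists_isLinkSolution_of_isBoundedNonneg hp hT hlam hb hd hr hv
  exact ⟨ρ, y, solution.congr hT r_eq v_eq, bounds⟩

lemma IsLinkSolution.exists_isSelfConsistent (h : IsLinkSolution T lam b d r₀ u ρ y) (hp : p ≠ ∞)
    (hT : 0 < T) (hlam : IsVelocityLaw T lam) (hb : b ∈ Icc (0 : ℝ) 1) (hd : d ∈ Icc (0 : ℝ) 1)
    (hr : ∀ k, IsBoundedNonneg (Ioo 0 1) (A k) (r₀ k))
    (hu : ∀ k, IsBoundedNonneg (Ioo 0 T) (B k) (u k)) :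
    ∃ m c, IsVelocity m c ∧ EqOn c (linkVelocity lam b d ρ) (Icc 0 T) ∧
      IsSelfConsistent T lam b d (fun x => ∑ k, r₀ k x) (fun t => ∑ k, u k t) c := by
  obtain ⟨m, c, hc, c_eq⟩ := exists_isVelocity_eqOn hT.le
    (continuousOn_linkVelocity hlam hb hd h.continuousOn) fun t ht => hlam.pos t ht _
  have hf (k : K) : MemLp (profile c (r₀ k) (u k)) p volume :=
    (hc.isBoundedNonneg_profile hT.le (hr k) (hu k)).memLp p
  have advected (k : K) : EqOn (ρ k) (fun t => advect (hf k) (displacement c t)) (Icc 0 T) :=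
    (((h.weak k).congr hT.le c_eq.symm .rfl .rfl).unique hc hT (h.continuousOn k)
      ((continuous_advect hp (hf k)).comp hc.continuous_displacement).continuousOn
      (h.integrable_outflow k)
      ((hc.isNonnegLinfty_outflow hT.le (hr k) (hu k)).integrableOn (by simp))
      (isWeakTransportSolution_advect hc hT.le (hr k) (hu k) (hf k))).1
  exact ⟨m, c, hc, c_eq, fun t ht =>
    (c_eq ht).trans (linkVelocity_eq_load hb hd hf fun k => advected k ht)⟩

lemma IsLinkSolution.unique (h : IsLinkSolution T lam b d r₀ u ρ y)
    (h' : IsLinkSolution T lam b d r₀ u ρ' y') (hp : p ≠ ∞) (hT : 0 < T)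
    (hlam : IsVelocityLaw T lam) (hb : b ∈ Icc (0 : ℝ) 1) (hd : d ∈ Icc (0 : ℝ) 1)
    (hr₀ : ∀ k, IsNonnegLinfty (Ioo 0 1) (r₀ k)) (hu : ∀ k, IsNonnegLinfty (Ioo 0 T) (u k))
    (k : K) : EqOn (ρ k) (ρ' k) (Icc 0 T) ∧ y k =ᵐ[volume.restrict (Ioo 0 T)] y' k := by
  choose A r hr r_eq using fun k => (hr₀ k).exists_isBoundedNonneg_ae_eq measurableSet_Ioo
  choose B v hv v_eq using fun k => (hu k).exists_isBoundedNonneg_ae_eq measurableSet_Ioo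
  replace h := h.congr hT.le (fun k => (r_eq k).symm) fun k => (v_eq k).symm
  replace h' := h'.congr hT.le (fun k => (r_eq k).symm) fun k => (v_eq k).symm
  obtain ⟨m₁, c₁, hc₁, velocity, consistent⟩ := h.exists_isSelfConsistent hp hT hlam hb hd hr hv
  obtain ⟨m₂, c₂, hc₂, velocity', consistent'⟩ := h'.exists_isSelfConsistent hp hT hlam hb hd hr hv
  obtain ⟨-, c, -, -, unique_velocity⟩ := hlam.exists_isSelfConsistent hT.le
    (IsBoundedNonneg.sum hr) (IsBoundedNonneg.sum hv) hb hd
  have same_velocity : EqOn c₂ c₁ (Icc 0 T) :=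
    (unique_velocity m₂ c₂ hc₂ consistent').trans (unique_velocity m₁ c₁ hc₁ consistent).symm
  exact ((h.weak k).congr hT.le velocity.symm .rfl .rfl).unique hc₁ hT (h.continuousOn k)
    (h'.continuousOn k) (h.integrable_outflow k) (h'.integrable_outflow k)
    ((h'.weak k).congr hT.le (velocity'.symm.trans same_velocity) .rfl .rfl)

end Link

/-! ### The network -/

namespace IsNonnegLinfty

variable {I : Set ℝ} {f g : ℝ → ℝ}

lemma add (hf : IsNonnegLinfty I f) (hg : IsNonnegLinfty I g) :
    IsNonnegLinfty I fun t => f t + g t :=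
  ⟨hf.1.add hg.1, by filter_upwards [hf.2, hg.2] with t using add_nonneg⟩

lemma mul (hf : IsNonnegLinfty I f) (hg : IsNonnegLinfty I g) :
    IsNonnegLinfty I fun t => f t * g t :=
  ⟨hg.1.mul hf.1, by filter_upwards [hf.2, hg.2] with t using mul_nonneg⟩

lemma sum {ι : Type*} (s : Finset ι) {f : ι → ℝ → ℝ} (hf : ∀ i ∈ s, IsNonnegLinfty I (f i)) :
    IsNonnegLinfty I fun t => ∑ i ∈ s, f i t :=
  ⟨memLp_finsetSum s fun i hi => (hf i hi).1,
    ((Finset.eventually_all s).2 fun i hi => (hf i hi).2).mono fun _ => Finset.sum_nonneg⟩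

end IsNonnegLinfty

lemma exists_forall_eq_of_wellFounded {ι β : Type*} [Nonempty β] {R : ι → ι → Prop}
    (hR : WellFounded R) (F : ι → (ι → β) → β)
    (hF : ∀ i y y', (∀ j, R j i → y j = y' j) → F i y = F i y') :
    ∃ y : ι → β, ∀ i, y i = F i y := by
  classical
  refine ⟨hR.fix fun i IH => F i fun j => if h : R j i then IH j h else Classical.arbitrary β,
    fun i => ?_⟩
  rw [hR.fix_eq]
  exact hF i _ _ fun j hj => dif_pos hj

namespace TrafficNetwork

section NodeInflow

variable {V K : Type*} [Fintype V] [DecidableEq V] {N : TrafficNetwork V} {T : ℝ}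
  {θ s y y' : N.Link → K → ℝ → ℝ} {a : N.Link}

/-- The inflow into the link `a` which the node condition at its origin prescribes if the outflows
of the links are `y`. -/
def nodeInflow (N : TrafficNetwork V) (θ s y : N.Link → K → ℝ → ℝ) (a : N.Link) (k : K)
    (t : ℝ) : ℝ :=
  s a k t + θ a k t * ∑ a' ∈ N.linksIn (origin a), y a' k t

lemma nodeInflow_congr (h : ∀ a', terminus a' = origin a → y a' = y' a') :
    N.nodeInflow θ s y a = N.nodeInflow θ s y' a := by
  ext k t
  refine congrArg (s a k t + θ a k t * ·) (Finset.sum_congr rfl fun a' ha' => ?_)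
  rw [h a' (Finset.mem_filter.1 ha').2]

lemma nodeInflow_ae_eq {k : K} (h : ∀ a', terminus a' = origin a →
      y a' k =ᵐ[volume.restrict (Ioo 0 T)] y' a' k) :
    N.nodeInflow θ s y a k =ᵐ[volume.restrict (Ioo 0 T)] N.nodeInflow θ s y' a k := by
  filter_upwards [(Finset.eventually_all (N.linksIn (origin a))).2
    fun a' ha' => h a' (Finset.mem_filter.1 ha').2] with t ht
  rw [nodeInflow, nodeInflow, Finset.sum_congr rfl ht]

lemma isNonnegLinfty_nodeInflow {k : K} (hθ : IsNonnegLinfty (Ioo 0 T) (θ a k))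
    (hs : IsNonnegLinfty (Ioo 0 T) (s a k))
    (hy : ∀ a', terminus a' = origin a → IsNonnegLinfty (Ioo 0 T) (y a' k)) :
    IsNonnegLinfty (Ioo 0 T) (N.nodeInflow θ s y a k) :=
  hs.add (hθ.mul (.sum _ fun a' ha' => hy a' (Finset.mem_filter.1 ha').2))

end NodeInflow

variable {V : Type*} [Fintype V] [DecidableEq V] {N : TrafficNetwork V}

lemma Acyclic.wellFounded (hN : N.Acyclic) :
    WellFounded fun a' a : N.Link => terminus a' = origin a := by
  let precedes : V → V → Prop := Relation.TransGen fun v w => (v, w) ∈ N.arcs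
  have : Std.Irrefl precedes := ⟨hN⟩
  have wellFounded_nodes : WellFounded precedes := Finite.wellFounded_of_trans_of_irrefl precedes
  refine Subrelation.wf (r := InvImage precedes origin) (fun {a' a} h => ?_)
    (InvImage.wf _ wellFounded_nodes)
  exact .single (h ▸ a'.2)

variable {D : Finset V} {T b d : ℝ} {p : ℝ≥0∞} [Fact (1 ≤ p)] {lam : N.Link → ℝ → ℝ → ℝ}
  {ρ0 θ s : N.Link → Commodity D → ℝ → ℝ}

theorem exists_isWeakSolution (hN : N.Acyclic) (hT : 0 ≤ T) (hp : p ≠ ∞)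
    (hlam : ∀ a, IsVelocityLaw T (lam a)) (hb : b ∈ Icc (0 : ℝ) 1) (hd : d ∈ Icc (0 : ℝ) 1)
    (hρ0 : ∀ a k, IsNonnegLinfty (Ioo 0 1) (ρ0 a k))
    (hθ : ∀ a k, IsNonnegLinfty (Ioo 0 T) (θ a k)) (hs : ∀ a k, IsNonnegLinfty (Ioo 0 T) (s a k)) :
    ∃ (ρ : N.Link → Commodity D → ℝ → LpUnit p) (u y : N.Link → Commodity D → ℝ → ℝ),
      N.IsWeakSolution D T lam b d ρ0 θ s ρ u y ∧
      (∀ a k, ∃ M : ℝ, ∀ t, ∀ᵐ x ∂volume.restrict (Ioo (0 : ℝ) 1),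
        0 ≤ ρ a k t x ∧ ρ a k t x ≤ M) ∧
      ∀ a k, IsNonnegLinfty (Ioo 0 T) (u a k) ∧ IsNonnegLinfty (Ioo 0 T) (y a k) := by
  choose! density outflow solution outflow_nonneg bounded using
    fun a u => exists_isLinkSolution (u := u) hp hT (hlam a) hb hd (hρ0 a)
  obtain ⟨y, hy⟩ := exists_forall_eq_of_wellFounded hN.wellFounded
    (fun a y => outflow a (N.nodeInflow θ s y a))
    fun a _ _ h => congrArg (outflow a) (nodeInflow_congr h)
  have hyL (a : N.Link) : ∀ k, IsNonnegLinfty (Ioo 0 T) (y a k) := by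
    induction a using hN.wellFounded.induction with
    | _ a IH =>
      rw [hy]
      exact outflow_nonneg a _ fun k =>
        isNonnegLinfty_nodeInflow (hθ a k) (hs a k) fun a' ha' => IH a' ha' k
  have huL (a : N.Link) (k : Commodity D) : IsNonnegLinfty (Ioo 0 T) (N.nodeInflow θ s y a k) :=
    isNonnegLinfty_nodeInflow (hθ a k) (hs a k) fun a' _ => hyL a' k
  refine ⟨fun a => density a (N.nodeInflow θ s y a), N.nodeInflow θ s y, y,
    ⟨fun a => (solution a _ (huL a)).continuousOn, fun a k => (huL a k).integrableOn (by simp),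
      fun a k => (hyL a k).integrableOn (by simp), fun a k => ?_,
      fun a k => .of_forall fun _ => rfl⟩,
    fun a => bounded a _ (huL a), fun a k => ⟨huL a k, hyL a k⟩⟩
  rw [hy]
  exact (solution a _ (huL a)).weak k

namespace IsWeakSolution

variable {ρ ρ' : N.Link → Commodity D → ℝ → LpUnit p} {u y u' y' : N.Link → Commodity D → ℝ → ℝ}

lemma isLinkSolution (h : N.IsWeakSolution D T lam b d ρ0 θ s ρ u y) (a : N.Link) :
    IsLinkSolution T (lam a) b d (ρ0 a) (u a) (ρ a) (y a) :=
  ⟨h.continuousOn a, h.integrable_outflow a, h.weak a⟩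

lemma inflow_ae_eq (h : N.IsWeakSolution D T lam b d ρ0 θ s ρ u y) (a : N.Link) (k : Commodity D) :
    u a k =ᵐ[volume.restrict (Ioo 0 T)] N.nodeInflow θ s y a k := h.node a k

theorem unique (h : N.IsWeakSolution D T lam b d ρ0 θ s ρ u y)
    (h' : N.IsWeakSolution D T lam b d ρ0 θ s ρ' u' y') (hN : N.Acyclic) (hT : 0 < T) (hp : p ≠ ∞)
    (hlam : ∀ a, IsVelocityLaw T (lam a)) (hb : b ∈ Icc (0 : ℝ) 1) (hd : d ∈ Icc (0 : ℝ) 1)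
    (hρ0 : ∀ a k, IsNonnegLinfty (Ioo 0 1) (ρ0 a k))
    (hu : ∀ a k, IsNonnegLinfty (Ioo 0 T) (u a k)) (a : N.Link) (k : Commodity D) :
    EqOn (ρ' a k) (ρ a k) (Icc 0 T) ∧ u' a k =ᵐ[volume.restrict (Ioo 0 T)] u a k ∧
      y' a k =ᵐ[volume.restrict (Ioo 0 T)] y a k := by
  induction a using hN.wellFounded.induction generalizing k with
  | _ a upstream =>
    have inflow (k : Commodity D) : u' a k =ᵐ[volume.restrict (Ioo 0 T)] u a k :=
      (h'.inflow_ae_eq a k).trans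
        ((nodeInflow_ae_eq fun a' ha' => (upstream a' ha' k).2.2).trans (h.inflow_ae_eq a k).symm)
    obtain ⟨density, outflow⟩ := ((h'.isLinkSolution a).congr hT.le (fun _ => .rfl) inflow).unique
      (h.isLinkSolution a) hp hT (hlam a) hb hd (hρ0 a) (hu a) k
    exact ⟨density, inflow k, outflow⟩

end IsWeakSolution

end TrafficNetwork

theorem mainTheorem2_general {V : Type*} [Fintype V] [DecidableEq V]
    (N : TrafficNetwork V) (hN : N.Acyclic) (D : Finset V)
    (T : ℝ) (hT : 0 < T) (p : ℝ≥0∞) [Fact (1 ≤ p)] (hp : p ≠ ∞)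
    (lam : N.Link → ℝ → ℝ → ℝ) (hlam : ∀ a, IsVelocityLaw T (lam a))
    (b d : ℝ) (hb : b ∈ Icc (0 : ℝ) 1) (hd : d ∈ Icc (0 : ℝ) 1)
    (ρ0 : N.Link → Commodity D → ℝ → ℝ) (hρ0 : ∀ a k, IsNonnegLinfty (Ioo 0 1) (ρ0 a k))
    (θ : N.Link → Commodity D → ℝ → ℝ) (hθ : ∀ a k, IsNonnegLinfty (Ioo 0 T) (θ a k))
    (s : N.Link → Commodity D → ℝ → ℝ) (hs : ∀ a k, IsNonnegLinfty (Ioo 0 T) (s a k)) :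
    ∃ (ρ : N.Link → Commodity D → ℝ → LpUnit p) (u y : N.Link → Commodity D → ℝ → ℝ),
      N.IsWeakSolution D T lam b d ρ0 θ s ρ u y ∧
      (∀ a k, ∃ M : ℝ, ∀ t ∈ Icc 0 T,
        ∀ᵐ x ∂volume.restrict (Ioo (0 : ℝ) 1), 0 ≤ ρ a k t x ∧ ρ a k t x ≤ M) ∧
      (∀ a k, ∀ᵐ t ∂volume.restrict (Ioo 0 T), 0 ≤ u a k t ∧ 0 ≤ y a k t) ∧
      ∀ (ρ' : N.Link → Commodity D → ℝ → LpUnit p) (u' y' : N.Link → Commodity D → ℝ → ℝ),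
        N.IsWeakSolution D T lam b d ρ0 θ s ρ' u' y' →
        ∀ a k, (∀ t ∈ Icc 0 T, ρ' a k t = ρ a k t) ∧
          ∀ᵐ t ∂volume.restrict (Ioo 0 T), u' a k t = u a k t ∧ y' a k t = y a k t := by
  obtain ⟨ρ, u, y, solution, bounded, flows⟩ :=
    TrafficNetwork.exists_isWeakSolution hN hT.le hp hlam hb hd hρ0 hθ hs
  refine ⟨ρ, u, y, solution, fun a k => ?_, fun a k => ?_, fun ρ' u' y' solution' a k => ?_⟩
  · obtain ⟨M, hM⟩ := bounded a k
    exact ⟨M, fun t _ => hM t⟩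
  · exact (flows a k).1.2.and (flows a k).2.2
  · obtain ⟨density, inflow, outflow⟩ :=
      solution.unique solution' hN hT hp hlam hb hd hρ0 (fun a k => (flows a k).1) a k
    exact ⟨density, inflow.and outflow⟩

theorem mainTheorem2 {V : Type*} [Fintype V] [DecidableEq V]
    (N : TrafficNetwork V) (hN : N.Acyclic) (D : Finset V)
    (T : ℝ) (hT : 0 < T) (p : ℝ≥0∞) [Fact (1 ≤ p)] (hp : p ≠ ∞)
    (lam : N.Link → ℝ → ℝ → ℝ)
    (hlam : ∀ a, ContDiffOn ℝ 1 (Function.uncurry (lam a)) (Icc 0 T ×ˢ univ))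
    (hlam_pos : ∀ a, ∀ t ∈ Icc 0 T, ∀ w, 0 < lam a t w)
    (b d : ℝ) (hb : b ∈ Icc (0 : ℝ) 1) (hd : d ∈ Icc (0 : ℝ) 1)
    (ρ0 : N.Link → Commodity D → ℝ → ℝ) (hρ0 : ∀ a k, IsNonnegLinfty (Ioo 0 1) (ρ0 a k))
    (θ : N.Link → Commodity D → ℝ → ℝ) (hθ : N.IsSplit D T θ)
    (s : N.Link → Commodity D → ℝ → ℝ) (hs : ∀ a k, IsNonnegLinfty (Ioo 0 T) (s a k)) :
    ∃ (ρ : N.Link → Commodity D → ℝ → LpUnit p) (u y : N.Link → Commodity D → ℝ → ℝ),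
      N.IsWeakSolution D T lam b d ρ0 θ s ρ u y ∧
      (∀ a k, ∃ M : ℝ, ∀ t ∈ Icc 0 T,
        ∀ᵐ x ∂volume.restrict (Ioo (0 : ℝ) 1), 0 ≤ ρ a k t x ∧ ρ a k t x ≤ M) ∧
      (∀ a k, ∀ᵐ t ∂volume.restrict (Ioo 0 T), 0 ≤ u a k t ∧ 0 ≤ y a k t) ∧
      ∀ (ρ' : N.Link → Commodity D → ℝ → LpUnit p) (u' y' : N.Link → Commodity D → ℝ → ℝ),
        N.IsWeakSolution D T lam b d ρ0 θ s ρ' u' y' →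
        ∀ a k, (∀ t ∈ Icc 0 T, ρ' a k t = ρ a k t) ∧
          ∀ᵐ t ∂volume.restrict (Ioo 0 T), u' a k t = u a k t ∧ y' a k t = y a k t :=
  mainTheorem2_general N hN D T hT p hp lam
    (fun a => .of_contDiffOn (hlam a) (hlam_pos a)) b d hb hd ρ0 hρ0 θ hθ.nonneg_linfty s hs
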